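/- Consider edge-to-edge tilings of the (oriented) sphere by finitely many pentagons, each a closed disk with five different vertices, whose corners carry labels from $\{\alpha,\beta,\gamma,\delta\}$. The tiles are assumed to be corner congruent: there is one cyclic arrangement of five labels such that in every tile the labels are arranged in this way, counterclockwise or clockwise. Tilings are regarded as combinatorial objects, up to label preserving isomorphisms that preserve or reverse the orientation; no angle values or edge lengths are used. A tiling is a tiling for \[\mathrm{AVC(4A24)}=\{24\,\alpha^2\beta\gamma\delta\colon 24\,\alpha^2\beta,\ 8\,\gamma^3,\ 6\,\delta^4\}\] if it has 24 tiles, each with corners labelled $\alpha,\alpha,\beta,\gamma,\delta$ (in some arrangement, the same for all tiles), and its vertices are exactly 24 vertices with corners $\alpha,\alpha,\beta$, 8 vertices with corners $\gamma,\gamma,\gamma$ and 6 vertices with corners $\delta,\delta,\delta,\delta$. Tilings for \[\mathrm{AVC(4A60)}=\{60\,\alpha^2\beta\gamma\delta\colon 60\,\alpha^2\beta,\ 20\,\gamma^3,\ 12\,\delta^5\}\] are defined in the same way. Let $PP_6$ and $PP_{12}$ be the pentagonal subdivisions of the cube and of the dodecahedron: every edge is divided into three segments by two new points, every face gets a central point,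 and the central point of a face is joined, for each edge of the face traversed counterclockwise around the face, to the second of the two new points on this edge. Thus each corner of a face, at a vertex $v$, gives one pentagon. Label its corners $\epsilon,\alpha,\delta,\beta,\gamma$ in counterclockwise order, with $\epsilon$ at the centre of the face and $\delta$ at $v$. The reductions $4\mathrm{A}_1,4\mathrm{A}_2,4\mathrm{A}_3$ replace the labels $\alpha,\beta,\gamma,\delta,\epsilon$ respectively by \[\beta,\alpha,\alpha,\gamma,\delta;\qquad \alpha,\beta,\alpha,\gamma,\delta;\qquad \alpha,\alpha,\beta,\gamma,\delta.\] Theorem. The tilings for $\mathrm{AVC(4A24)}$ are exactly the $4\mathrm{A}_1$, $4\mathrm{A}_2$ and $4\mathrm{A}_3$ reductions of $PP_6$, and the tilings for $\mathrm{AVC(4A60)}$ are exactly the $4\mathrm{A}_1$, $4\mathrm{A}_2$ and $4\mathrm{A}_3$ reductions of $PP_{12}$. -/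

import Mathlib

/-- A cellular decomposition of a closed oriented surface, given by its darts.
Every edge of every tile, traversed counterclockwise around the tile, is one dart; equivalently,
a dart stands for the corner of its tile at the initial vertex of the dart.
`face d` is the next dart (corner) counterclockwise around the tile of `d`, and `edge d` is the
dart that traverses the same edge in the opposite direction, along the tile on its other side. -/
structure SurfaceMap (D : Type*) where
  face : Equiv.Perm D
  edge : Equiv.Perm D
  edge_edge : ∀ d, edge (edge d) = d
  edge_ne : ∀ d, edge d ≠ d

namespace SurfaceMap

variable {D : Type*} (M : SurfaceMap D)

/-- The next corner (clockwise) around the initial vertex of a dart. -/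
def vertex : Equiv.Perm D := M.face * M.edge

/-- The vertices are the cycles of `vertex`. -/
abbrev Vertex : Type _ := Quotient (Equiv.Perm.SameCycle.setoid M.vertex)

/-- The edges are the cycles of `edge`. -/
abbrev Edge : Type _ := Quotient (Equiv.Perm.SameCycle.setoid M.edge)

/-- The tiles are the cycles of `face`. -/
abbrev Tile : Type _ := Quotient (Equiv.Perm.SameCycle.setoid M.face)

/-- The surface is connected: one can go from any dart to any other by `face` and `edge`. -/
def Connected : Prop :=
  ∀ x y : D, ∃ g ∈ Subgroup.closure ({M.face, M.edge} : Set (Equiv.Perm D)), g x = y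

/-- The surface is the sphere: it is connected and its Euler characteristic is `2`. -/
def IsSphere : Prop :=
  M.Connected ∧
    (Nat.card M.Vertex : ℤ) - (Nat.card M.Edge : ℤ) + (Nat.card M.Tile : ℤ) = 2

/-- Every tile is a pentagon with five different vertices (so that the closed tile is a disk). -/
def IsPentagonal : Prop :=
  ∀ d : D, Function.minimalPeriod M.face d = 5 ∧
    ∀ k : ℕ, 0 < k → k < 5 → ¬ M.vertex.SameCycle d ((M.face ^ k) d)

/-- The same decomposition with the opposite orientation, on the same set of corners. The edge that
starts at the corner `d` in the old orientation starts at the corner `face d` in the new one. -/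
def mirror : SurfaceMap D where
  face := M.face⁻¹
  edge := M.face * M.edge * M.face⁻¹
  edge_edge d := by simp [M.edge_edge]
  edge_ne d h := M.edge_ne (M.face⁻¹ d) (by
    apply M.face.injective
    simpa using h)

end SurfaceMap

/-- A decomposition of a surface with a label on each corner of each tile. -/
structure LabelledMap (D : Type*) (L : Type*) extends SurfaceMap D where
  label : D → L

/-- The data written as `{f p : y₁ V₁, …, yₙ Vₙ}`: the number `f` of tiles, the multiset `p` of
labels of the corners of each tile, and the multiset of all vertices, each vertex being the
multiset of labels of the corners at it. -/
structure AVC (L : Type*) where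
  numTiles : ℕ
  tile : Multiset L
  vertices : Multiset (Multiset L)

namespace LabelledMap

variable {D D' L L' : Type*}

/-- The labels of the corners at a vertex, with multiplicity. -/
noncomputable def labelsAt [Fintype D] (T : LabelledMap D L) (v : T.Vertex) : Multiset L :=
  open Classical in
  ((Finset.univ.filter fun d : D => (Quotient.mk _ d : T.Vertex) = v).val).map T.label

/-- All tiles are congruent pentagons with the cyclic arrangement `p` of labels: in each tile the
labels are arranged as in `p`, counterclockwise or clockwise. -/
def TilesCongruentTo (T : LabelledMap D L) (p : Fin 5 → L) : Prop :=
  ∀ d : D, ∃ k : Fin 5,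
    (∀ i : Fin 5, T.label ((T.face ^ (i : ℕ)) d) = p (k + i)) ∨
    (∀ i : Fin 5, T.label ((T.face ^ (i : ℕ)) d) = p (k - i))

/-- `T` is an edge-to-edge tiling of the sphere by corner congruent pentagons with the given
anglewise vertex combination. The arrangement of the labels in the pentagon is arbitrary. -/
def IsTilingFor [Fintype D] [DecidableEq L] (T : LabelledMap D L) (A : AVC L) : Prop :=
  T.IsSphere ∧ T.IsPentagonal ∧
  (∃ p : Fin 5 → L, Finset.univ.val.map p = A.tile ∧ T.TilesCongruentTo p) ∧
  Nat.card T.Tile = A.numTiles ∧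
  ∀ m : Multiset L, Nat.card {v : T.Vertex // T.labelsAt v = m} = A.vertices.count m

/-- Change of labels. -/
def relabel (T : LabelledMap D L) (r : L → L') : LabelledMap D L' where
  toSurfaceMap := T.toSurfaceMap
  label d := r (T.label d)

/-- The labelled map with the opposite orientation. -/
def mirror (T : LabelledMap D L) : LabelledMap D L where
  toSurfaceMap := T.toSurfaceMap.mirror
  label := T.label

/-- Orientation preserving isomorphism of labelled maps. -/
def OrientedIso (T : LabelledMap D L) (T' : LabelledMap D' L) : Prop :=
  ∃ e : D ≃ D', (∀ d, e (T.face d) = T'.face (e d)) ∧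
    (∀ d, e (T.edge d) = T'.edge (e d)) ∧ ∀ d, T'.label (e d) = T.label d

/-- Isomorphism of labelled maps, preserving or reversing the orientation. -/
def Iso (T : LabelledMap D L) (T' : LabelledMap D' L) : Prop :=
  T.OrientedIso T' ∨ T.mirror.OrientedIso T'

end LabelledMap

/-! ### Pentagonal subdivision -/

/-- The five corners of the pentagon. -/
inductive Angle5 where
  | α | β | γ | δ | ε
  deriving DecidableEq

instance : Fintype Angle5 :=
  ⟨{.α, .β, .γ, .δ, .ε}, by rintro (_ | _ | _ | _ | _) <;> decide⟩

/-- Four labels. -/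
inductive Angle4 where
  | α | β | γ | δ
  deriving DecidableEq

instance : Fintype Angle4 :=
  ⟨{.α, .β, .γ, .δ}, by rintro (_ | _ | _ | _) <;> decide⟩

namespace Angle5

/-- The corners are arranged counterclockwise in the pentagon as `α, δ, β, γ, ε`. -/
def next : Angle5 → Angle5
  | α => δ
  | δ => β
  | β => γ
  | γ => ε
  | ε => α

/-- The inverse of `next`. -/
def prev : Angle5 → Angle5
  | δ => α
  | β => δ
  | γ => β
  | ε => γ
  | α => ε

end Angle5

namespace SurfaceMap

variable {D : Type*} (M : SurfaceMap D)

/-- Edges in the pentagonal subdivision, see `pentagonalSubdivision`. -/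
def subdivisionEdge : D × Angle5 → D × Angle5
  | (d, .α) => (M.edge (M.face⁻¹ d), .δ)
  | (d, .δ) => (M.face (M.edge d), .α)
  | (d, .β) => (M.edge d, .β)
  | (d, .γ) => (M.face d, .ε)
  | (d, .ε) => (M.face⁻¹ d, .γ)

theorem subdivisionEdge_involutive : Function.Involutive M.subdivisionEdge := by
  rintro ⟨d, _ | _ | _ | _ | _⟩ <;> simp [subdivisionEdge, M.edge_edge]

/-- The pentagonal subdivision of a map. Two points are added inside every edge, so that it is cut
into three segments, with `p d` the one closer to the initial vertex of the dart `d`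
(and `p (edge d)` the other one). In every tile a central point `c` is added and joined to the
point `p (edge d)` for every dart `d` of the boundary of the tile.
This cuts every tile into pentagons, one for each corner `d` of the tile, with vertices
(counterclockwise) `c`, `p (edge (face⁻¹ d))`, the initial vertex of `d`, `p d`, `p (edge d)`.
The corners of the pentagon at these points are labelled `ε, α, δ, β, γ`. -/
def pentagonalSubdivision : LabelledMap (D × Angle5) Angle5 where
  face :=
    { toFun := fun x => (x.1, x.2.next)
      invFun := fun x => (x.1, x.2.prev)
      left_inv := by rintro ⟨d, _ | _ | _ | _ | _⟩ <;> rfl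
      right_inv := by rintro ⟨d, _ | _ | _ | _ | _⟩ <;> rfl }
  edge := M.subdivisionEdge_involutive.toPerm
  edge_edge := M.subdivisionEdge_involutive
  edge_ne := by
    rintro ⟨d, _ | _ | _ | _ | _⟩ <;> simp [subdivisionEdge, M.edge_ne]
  label := Prod.snd

end SurfaceMap

/-! ### The cube and the dodecahedron -/

/-- Let `F i 0, …, F i (n - 1)` be the vertices of the `i`-th face of a polyhedron in
counterclockwise order. The sides from `F i k` to `F i (k + 1)` and from `F j l` to `F j (l + 1)`
are the same edge, in opposite directions. -/
def OppositeSides {ι V : Type*} {n : ℕ} [NeZero n] (F : ι → Fin n → V) (x y : ι × Fin n) : Prop :=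
  F x.1 x.2 = F y.1 (y.2 + 1) ∧ F y.1 y.2 = F x.1 (x.2 + 1)

instance {ι V : Type*} [DecidableEq V] {n : ℕ} [NeZero n] (F : ι → Fin n → V) (x y : ι × Fin n) :
    Decidable (OppositeSides F x y) :=
  inferInstanceAs (Decidable (_ ∧ _))

/-- The boundary surface of a polyhedron whose faces are listed by `F`. -/
def polyhedron {ι V : Type*} [Fintype ι] [DecidableEq ι] [DecidableEq V] {n : ℕ} [NeZero n]
    (F : ι → Fin n → V) (h : ∀ x : ι × Fin n, ∃! y, OppositeSides F x y)
    (hF : ∀ (i : ι) (k : Fin n), F i k ≠ F i (k + 1)) : SurfaceMap (ι × Fin n) where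
  face := Equiv.prodCongr (Equiv.refl ι) (Equiv.addRight 1)
  edge := Function.Involutive.toPerm
    (fun x => Fintype.choose (fun y => OppositeSides F x y) (h x)) (fun x =>
      (h _).unique (Fintype.choose_spec _ (h _)) (Fintype.choose_spec _ (h x)).symm)
  edge_edge x :=
    (h _).unique (Fintype.choose_spec _ (h _)) (Fintype.choose_spec _ (h x)).symm
  edge_ne x hx := by
    have h1 := Fintype.choose_spec (fun y => OppositeSides F x y) (h x)
    have h2 : Fintype.choose (fun y => OppositeSides F x y) (h x) = x := hx
    rw [h2] at h1
    exact hF _ _ h1.1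

/-- The faces of the cube; the vertex with coordinates `x, y, z ∈ {0, 1}` is `x + 2 y + 4 z`. -/
def cubeFaces : Fin 6 → Fin 4 → Fin 8 :=
  ![![0, 2, 3, 1], ![4, 5, 7, 6], ![0, 1, 5, 4], ![2, 6, 7, 3], ![0, 4, 6, 2], ![1, 3, 7, 5]]

/-- The faces of the dodecahedron. The vertices `0, …, 4` form the top face and `15, …, 19` the
bottom face; `5, …, 9` are joined to the top face, `10, …, 14` to the bottom face. -/
def dodecahedronFaces : Fin 12 → Fin 5 → Fin 20 :=
  ![![0, 1, 2, 3, 4],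
    ![1, 0, 5, 10, 6], ![2, 1, 6, 11, 7], ![3, 2, 7, 12, 8], ![4, 3, 8, 13, 9], ![0, 4, 9, 14, 5],
    ![11, 6, 10, 15, 16], ![12, 7, 11, 16, 17], ![13, 8, 12, 17, 18], ![14, 9, 13, 18, 19],
    ![10, 5, 14, 19, 15],
    ![19, 18, 17, 16, 15]]

/-- The cube. -/
def cube : SurfaceMap (Fin 6 × Fin 4) :=
  polyhedron cubeFaces (by unfold ExistsUnique; decide +kernel) (by decide +kernel)

/-- The dodecahedron. -/
def dodecahedron : SurfaceMap (Fin 12 × Fin 5) :=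
  polyhedron dodecahedronFaces (by unfold ExistsUnique; decide +kernel) (by decide +kernel)

/-- The pentagonal subdivision of the cube, with the labels `α, β, γ, δ, ε`. -/
def PP6 : LabelledMap ((Fin 6 × Fin 4) × Angle5) Angle5 := cube.pentagonalSubdivision

/-- The pentagonal subdivision of the dodecahedron, with the labels `α, β, γ, δ, ε`. -/
def PP12 : LabelledMap ((Fin 12 × Fin 5) × Angle5) Angle5 := dodecahedron.pentagonalSubdivision

/-! ### Reductions to four labels -/

/-- `β = γ`: `α, β, γ, δ, ε → β, α, α, γ, δ`. -/
def reduction4A1 : Angle5 → Angle4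
  | .α => .β
  | .β => .α
  | .γ => .α
  | .δ => .γ
  | .ε => .δ

/-- `α = γ`: `α, β, γ, δ, ε → α, β, α, γ, δ`. -/
def reduction4A2 : Angle5 → Angle4
  | .α => .α
  | .β => .β
  | .γ => .α
  | .δ => .γ
  | .ε => .δ

/-- `α = β`: `α, β, γ, δ, ε → α, α, β, γ, δ`. -/
def reduction4A3 : Angle5 → Angle4
  | .α => .α
  | .β => .α
  | .γ => .β
  | .δ => .γ
  | .ε => .δ

/-- `{24 α²βγδ : 24 α²β, 8 γ³, 6 δ⁴}`. -/
def AVC4A24 : AVC Angle4 where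
  numTiles := 24
  tile := {.α, .α, .β, .γ, .δ}
  vertices := Multiset.replicate 24 {.α, .α, .β} + Multiset.replicate 8 {.γ, .γ, .γ} +
    Multiset.replicate 6 {.δ, .δ, .δ, .δ}

/-- `{60 α²βγδ : 60 α²β, 20 γ³, 12 δ⁵}`. -/
def AVC4A60 : AVC Angle4 where
  numTiles := 60
  tile := {.α, .α, .β, .γ, .δ}
  vertices := Multiset.replicate 60 {.α, .α, .β} + Multiset.replicate 20 {.γ, .γ, .γ} +
    Multiset.replicate 12 {.δ, .δ, .δ, .δ, .δ}

/-! The labels force each tile to sit as in a pentagonal subdivision, and the base polyhedron can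
then be recovered from the tiling.

Local part. Up to rotation and reflection, α, α, β, γ, δ have six cyclic arrangements: the three
reductions and three others (`exists_arrangement`). At a vertex, α and β can only be next to α or β,
γ only to γ, δ only to δ. Two neighbouring corners at a vertex share an edge, and the corners of the
same two tiles at its other end are neighbours as well (`FitsAround`). A finite check around a
single vertex of degree three then excludes the other arrangements (`IsOtherArrangement.not_fits`),
and shows that in a reduction the tiles at α²β are placed as in the subdivision, with a common
orientation (`IsReduction.eq_around`). In a reduction γ and δ are not adjacent in the pentagon, so
every edge has an end of type α²β; hence orientations agree across edges and, by connectedness,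
everywhere. Up to a mirror image this gives `IsReducedBy`.

Global part. Each tile has one corner at position `δ` of the pentagon. Walks between these corners
define maps `F` and `E` with F^q = E² = (FE)³ = 1, the face and edge maps of the hidden base
polyhedron. The cube and the dodecahedron are universal for these relations
(`isUniversal_of_paths`), which yields an equivariant map from their subdivision to the tiling; it
is onto by connectedness and bijective because both sides have 5N darts (`IsReducedBy.orientedIso`).

Conversely, `IsReducedBy` determines all vertices and their numbers by double counting
(`IsReducedBy.isTilingFor`); reversed isomorphisms are handled by `IsTilingFor.mirror`. -/

/-! ### Cycles of a permutation and the labels on them -/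

section Cycles

variable {D L : Type*}

theorem Equiv.Perm.sameCycle_iff_exists_lt_minimalPeriod [Finite D] (σ : Equiv.Perm D) (d x : D) :
    σ.SameCycle d x ↔ ∃ i < Function.minimalPeriod σ d, (σ ^ i) d = x := by
  constructor
  · intro h
    obtain ⟨i, hi⟩ := h.exists_nat_pow_eq
    refine ⟨i % Function.minimalPeriod σ d, Nat.mod_lt _ ?_, ?_⟩
    · apply Function.minimalPeriod_pos_of_mem_periodicPts
      exact σ.injective.mem_periodicPts d
    · rw [← hi, ← Equiv.Perm.iterate_eq_pow, ← Equiv.Perm.iterate_eq_pow,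
        Function.iterate_mod_minimalPeriod_eq]
  · rintro ⟨i, -, rfl⟩
    exact ⟨i, by simp⟩

/-- The labels on a cycle of a permutation, with multiplicity. -/
noncomputable def orbitLabels [Fintype D] (σ : Equiv.Perm D) (f : D → L)
    (v : Quotient (Equiv.Perm.SameCycle.setoid σ)) : Multiset L :=
  open Classical in
  ((Finset.univ.filter fun d : D =>
    (Quotient.mk _ d : Quotient (Equiv.Perm.SameCycle.setoid σ)) = v).val).map f

theorem orbitLabels_mk [Fintype D] (σ : Equiv.Perm D) (f : D → L) (d : D) :
    orbitLabels σ f (Quotient.mk _ d) =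
      (Multiset.range (Function.minimalPeriod σ d)).map fun i => f ((σ ^ i) d) := by
  classical
  have h : (Finset.univ.filter fun x : D =>
      (Quotient.mk _ x : Quotient (Equiv.Perm.SameCycle.setoid σ)) = Quotient.mk _ d) =
      (Finset.range (Function.minimalPeriod σ d)).image fun i => (σ ^ i) d := by
    ext x
    simp only [Finset.mem_filter, Finset.mem_univ, true_and, Finset.mem_image, Finset.mem_range]
    rw [Quotient.eq, ← Equiv.Perm.sameCycle_iff_exists_lt_minimalPeriod]
    exact Equiv.Perm.sameCycle_comm
  have hinj : Set.InjOn (fun i => (σ ^ i) d)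
      (Finset.range (Function.minimalPeriod σ d) : Set ℕ) := by
    intro i hi j hj hij
    simp only [Finset.coe_range] at hi hj
    refine Function.iterate_injOn_Iio_minimalPeriod hi hj ?_
    simpa [Equiv.Perm.iterate_eq_pow] using hij
  unfold orbitLabels
  simp only [h]
  rw [Finset.image_val_of_injOn hinj, Multiset.map_map]
  rfl

theorem count_orbitLabels [Fintype D] [DecidableEq L] (σ : Equiv.Perm D) (f : D → L) (a : L)
    (v : Quotient (Equiv.Perm.SameCycle.setoid σ)) :
    (orbitLabels σ f v).count a = Nat.card {d : D // f d = a ∧ Quotient.mk _ d = v} := by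
  classical
  unfold orbitLabels
  rw [Multiset.count_map, ← Finset.filter_val, Finset.card_val, Nat.card_eq_fintype_card,
    Fintype.card_subtype, Finset.filter_filter]
  congr 1
  ext d
  simp [and_comm, eq_comm]

/-- Double counting of the elements labelled `a`, grouped by their cycles. All vertex, tile and edge
counts come from this. -/
theorem card_label_eq_count_mul [Fintype D] [DecidableEq L] (σ : Equiv.Perm D) (f : D → L) (a : L)
    (m : Multiset L) (h : ∀ d, f d = a → orbitLabels σ f (Quotient.mk _ d) = m) :
    Nat.card {d : D // f d = a} = m.count a * Nat.card {v // orbitLabels σ f v = m} := by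
  classical
  have e : {d : D // f d = a} ≃
      Σ v : {v // orbitLabels σ f v = m}, {d : D // f d = a ∧ Quotient.mk _ d = v.1} :=
    { toFun := fun d => ⟨⟨Quotient.mk _ d.1, h d.1 d.2⟩, ⟨d.1, d.2, rfl⟩⟩
      invFun := fun x => ⟨x.2.1, x.2.2.1⟩
      left_inv := fun d => rfl
      right_inv := by
        rintro ⟨⟨v, hv⟩, ⟨d, hd, hd'⟩⟩
        have hd'' : Quotient.mk _ d = v := hd'
        subst hd''
        rfl }
  rw [Nat.card_congr e, Nat.card_sigma]
  rw [Finset.sum_congr rfl (g := fun _ => m.count a)]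
  · simp [mul_comm]
  · rintro ⟨v, hv⟩ -
    rw [← count_orbitLabels, hv]

theorem card_eq_mul_card_cycles [Fintype D] (σ : Equiv.Perm D) (n : ℕ)
    (h : ∀ d, Function.minimalPeriod σ d = n) :
    Nat.card D = n * Nat.card (Quotient (Equiv.Perm.SameCycle.setoid σ)) := by
  have h' : ∀ v, orbitLabels σ (fun _ => ()) v = Multiset.replicate n () := by
    intro v
    induction v using Quotient.inductionOn with
    | h d => rw [orbitLabels_mk, h, Multiset.map_const', Multiset.card_range]
  have := card_label_eq_count_mul σ (fun _ => ()) () (Multiset.replicate n ()) fun d _ => h' _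
  rw [Multiset.count_replicate_self, Nat.card_congr (Equiv.subtypeUnivEquiv h'),
    Nat.card_congr (Equiv.subtypeUnivEquiv fun _ => rfl)] at this
  exact this

end Cycles

/-! ### Mirror images and connectedness. -/

namespace SurfaceMap

variable {D : Type*} (M : SurfaceMap D)

theorem edge_inv : M.edge⁻¹ = M.edge := by
  ext d
  rw [Equiv.Perm.inv_eq_iff_eq, M.edge_edge]

theorem vertex_apply (d : D) : M.vertex d = M.face (M.edge d) := rfl

theorem vertex_edge (d : D) : M.vertex (M.edge d) = M.face d := by
  rw [vertex_apply, edge_edge]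

theorem mirror_vertex : M.mirror.vertex = M.vertex⁻¹ := by
  unfold vertex mirror
  simp [mul_assoc, M.edge_inv]

theorem mirror_mirror : M.mirror.mirror = M := by
  cases M
  simp [mirror, mul_assoc]

theorem minimalPeriod_edge (d : D) : Function.minimalPeriod M.edge d = 2 :=
  Function.minimalPeriod_eq_prime (M.edge_edge d) (M.edge_ne d)

/-- A nonempty set of darts that is closed under `face` and `edge` contains all darts. -/
theorem Connected.induction [Finite D] {M : SurfaceMap D} (h : M.Connected) {P : D → Prop}
    (hf : ∀ d, P d → P (M.face d)) (he : ∀ d, P d → P (M.edge d)) {x : D} (hx : P x) (y : D) :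
    P y := by
  obtain ⟨g, hg, rfl⟩ := h x y
  have key : ∀ g ∈ Subgroup.closure ({M.face, M.edge} : Set (Equiv.Perm D)), ∀ z, P z → P (g z) := by
    intro g hg
    induction hg using Subgroup.closure_induction'' with
    | mem g hg =>
      rcases hg with rfl | rfl
      exacts [hf, he]
    | inv_mem g hg =>
      intro z hz
      have hgP : ∀ z, P z → P (g z) := by
        rcases hg with rfl | rfl
        exacts [hf, he]
      obtain ⟨n, hn, hn'⟩ := isOfFinOrder_iff_pow_eq_one.1 (isOfFinOrder_of_finite g)
      have hpow : ∀ k, P ((g ^ k) z) := by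
        intro k
        induction k with
        | zero => exact hz
        | succ k ih => rw [pow_succ']; exact hgP _ ih
      -- On a finite set the inverse of a generator is a power of it, so closure under `face` and
      -- `edge` suffices.
      have : g⁻¹ = g ^ (n - 1) := by
        rw [inv_eq_iff_mul_eq_one, ← pow_succ', Nat.sub_add_cancel hn, hn']
      rw [this]
      exact hpow _
    | one => exact fun z hz => hz
    | mul g k _ _ hg hk => exact fun z hz => hg _ (hk _ hz)
  exact key g hg x hx

/-- A map is connected if every dart can be reached from a given one. -/
theorem connected_of_induction {M : SurfaceMap D} (x : D)
    (h : ∀ P : D → Prop, (∀ d, P d → P (M.face d)) → (∀ d, P d → P (M.edge d)) → P x → ∀ y, P y) :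
    M.Connected := by
  have key : ∀ y, ∃ g ∈ Subgroup.closure ({M.face, M.edge} : Set (Equiv.Perm D)), g x = y := by
    apply h
    · rintro d ⟨g, hg, rfl⟩
      exact ⟨M.face * g, mul_mem (Subgroup.subset_closure (by simp)) hg, rfl⟩
    · rintro d ⟨g, hg, rfl⟩
      exact ⟨M.edge * g, mul_mem (Subgroup.subset_closure (by simp)) hg, rfl⟩
    · exact ⟨1, one_mem _, rfl⟩
  intro y z
  obtain ⟨g, hg, rfl⟩ := key y
  obtain ⟨k, hk, rfl⟩ := key z
  exact ⟨k * g⁻¹, mul_mem hk (inv_mem hg), by simp⟩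

theorem Connected.mirror {M : SurfaceMap D} (h : M.Connected) : M.mirror.Connected := by
  intro x y
  obtain ⟨g, hg, rfl⟩ := h x y
  refine ⟨g, ?_, rfl⟩
  revert g
  change Subgroup.closure _ ≤ _
  rw [Subgroup.closure_le]
  have hf : M.face⁻¹ ∈ Subgroup.closure ({M.mirror.face, M.mirror.edge} : Set (Equiv.Perm D)) :=
    Subgroup.subset_closure (by simp [SurfaceMap.mirror])
  have he : M.face * M.edge * M.face⁻¹ ∈
      Subgroup.closure ({M.mirror.face, M.mirror.edge} : Set (Equiv.Perm D)) :=
    Subgroup.subset_closure (by simp [SurfaceMap.mirror])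
  rintro g (rfl | rfl)
  · simpa using inv_mem hf
  · simpa [mul_assoc] using mul_mem (mul_mem hf he) (inv_mem hf)

end SurfaceMap

theorem setoid_sameCycle_inv {D : Type*} (σ : Equiv.Perm D) :
    Equiv.Perm.SameCycle.setoid σ⁻¹ = Equiv.Perm.SameCycle.setoid σ := by
  ext x y
  exact Equiv.Perm.sameCycle_inv

theorem Equiv.Perm.minimalPeriod_inv {D : Type*} (σ : Equiv.Perm D) (d : D) :
    Function.minimalPeriod (σ⁻¹ : Equiv.Perm D) d = Function.minimalPeriod σ d := by
  have key : ∀ (τ : Equiv.Perm D) n, Function.IsPeriodicPt τ n d →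
      Function.IsPeriodicPt (τ⁻¹ : Equiv.Perm D) n d := by
    intro τ n h
    unfold Function.IsPeriodicPt Function.IsFixedPt at *
    rw [Equiv.Perm.iterate_eq_pow] at *
    rw [inv_pow, Equiv.Perm.inv_eq_iff_eq, h]
  apply Nat.dvd_antisymm
  · exact Function.IsPeriodicPt.minimalPeriod_dvd (key _ _ (Function.isPeriodicPt_minimalPeriod σ d))
  · apply Function.IsPeriodicPt.minimalPeriod_dvd
    have := key σ⁻¹ _ (Function.isPeriodicPt_minimalPeriod (σ⁻¹ : Equiv.Perm D) d)
    rwa [inv_inv] at this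

namespace LabelledMap

variable {D L : Type*}

theorem mirror_mirror (T : LabelledMap D L) : T.mirror.mirror = T := by
  cases T
  simp [mirror, SurfaceMap.mirror_mirror]

theorem labelsAt_eq_orbitLabels [Fintype D] (T : LabelledMap D L) (v : T.Vertex) :
    T.labelsAt v = orbitLabels T.vertex T.label v := rfl

theorem IsTilingFor.mirror [Fintype D] [DecidableEq L] {T : LabelledMap D L} {A : AVC L}
    (h : T.IsTilingFor A) : T.mirror.IsTilingFor A := by
  obtain ⟨⟨hc, hE⟩, hP, ⟨p, hp, hT⟩, hn, hv⟩ := h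
  have hvert : T.mirror.vertex = T.vertex⁻¹ := T.toSurfaceMap.mirror_vertex
  have hface : T.mirror.face = T.face⁻¹ := rfl
  have h5 : ∀ d, (T.face ^ 5) d = d := by
    intro d
    rw [← Equiv.Perm.iterate_eq_pow, ← (hP d).1]
    exact Function.isPeriodicPt_minimalPeriod _ _
  have hpow : ∀ (d : D) (i j : ℕ), i + j = 5 → ((T.face⁻¹) ^ i) d = (T.face ^ j) d := by
    intro d i j hij
    rw [inv_pow, Equiv.Perm.inv_eq_iff_eq, ← Equiv.Perm.mul_apply, ← pow_add, hij, h5]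
  have hsV : Equiv.Perm.SameCycle.setoid T.mirror.vertex = Equiv.Perm.SameCycle.setoid T.vertex := by
    rw [hvert, setoid_sameCycle_inv]
  have hcV : Nat.card T.mirror.Vertex = Nat.card T.Vertex := by
    change Nat.card (Quotient _) = Nat.card (Quotient _)
    rw [hsV]
  have hcT : Nat.card T.mirror.Tile = Nat.card T.Tile := by
    change Nat.card (Quotient _) = Nat.card (Quotient _)
    rw [hface, setoid_sameCycle_inv]
  have hcE : Nat.card T.mirror.Edge = Nat.card T.Edge := by
    have h1 := card_eq_mul_card_cycles T.mirror.edge 2 T.mirror.minimalPeriod_edge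
    have h2 := card_eq_mul_card_cycles T.edge 2 T.minimalPeriod_edge
    exact Nat.eq_of_mul_eq_mul_left two_pos (h1.symm.trans h2)
  refine ⟨⟨hc.mirror, by rw [hcV, hcT, hcE]; exact hE⟩, ?_, ⟨p, hp, ?_⟩, hcT.trans hn, ?_⟩
  · intro d
    refine ⟨by rw [hface, Equiv.Perm.minimalPeriod_inv]; exact (hP d).1, ?_⟩
    intro k hk hk5
    rw [hvert, Equiv.Perm.sameCycle_inv, hface, hpow d k (5 - k) (by omega)]
    exact (hP d).2 _ (by omega) (by omega)
  · intro d
    obtain ⟨k, hk⟩ := hT d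
    refine ⟨k, ?_⟩
    -- Reversing a tile negates the index modulo 5, which exchanges the readings `k + i` and `k - i`
    -- of `p`.
    have hneg : ∀ i : Fin 5, ((T.mirror.face) ^ (i : ℕ)) d = (T.face ^ ((-i : Fin 5) : ℕ)) d := by
      intro i
      rw [hface]
      fin_cases i
      · rfl
      all_goals exact hpow d _ _ (by decide)
    rcases hk with hk | hk
    · right
      intro i
      rw [hneg, sub_eq_add_neg, ← hk]
      rfl
    · left
      intro i
      rw [hneg, ← sub_neg_eq_add, ← hk]
      rfl
  · intro m
    rw [← hv m]
    -- A variable `σ` is used because the type of vertices depends on the permutation.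
    have key : ∀ σ : Equiv.Perm D, σ = T.vertex⁻¹ →
        Nat.card {v // orbitLabels σ T.label v = m} =
          Nat.card {v // orbitLabels T.vertex T.label v = m} := by
      rintro σ rfl
      unfold orbitLabels
      rw [setoid_sameCycle_inv]
    exact key _ hvert

end LabelledMap

/-! ### Reductions of pentagonal subdivisions, described by the positions of the corners -/

namespace Angle5

/-- The corners at a vertex of a pentagonal subdivision, in the cyclic order given by `vertex`. -/
def atVertex : Angle5 → Angle5
  | α => β
  | β => γ
  | γ => α
  | δ => δ
  | ε => ε

/-- The degree of the vertex at a corner in the pentagonal subdivision of a map with tiles of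
degree `q` and vertices of degree three. -/
def degree (q : ℕ) : Angle5 → ℕ
  | ε => q
  | _ => 3

/-- The labels at the vertex of a corner after the reduction to four labels. -/
def vertexLabels (q : ℕ) : Angle5 → Multiset Angle4
  | ε => Multiset.replicate q .δ
  | δ => {.γ, .γ, .γ}
  | _ => {.α, .α, .β}

end Angle5

/-- One of the three reductions to four labels. -/
def IsReduction (r : Angle5 → Angle4) : Prop :=
  r = reduction4A1 ∨ r = reduction4A2 ∨ r = reduction4A3

instance (r : Angle5 → Angle4) : Decidable (IsReduction r) :=
  inferInstanceAs (Decidable (_ ∨ _ ∨ _))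

namespace IsReduction

theorem exists_unique_corner {r : Angle5 → Angle4} (hr : IsReduction r) :
    ∀ x : Angle4, x ≠ .α → ∃ a, ∀ b, r b = x ↔ b = a := by
  rcases hr with rfl | rfl | rfl <;> decide

theorem tile_labels {r : Angle5 → Angle4} (hr : IsReduction r) :
    ({r .α, r .β, r .γ, r .δ, r .ε} : Multiset Angle4) = {.α, .α, .β, .γ, .δ} := by
  rcases hr with rfl | rfl | rfl <;> decide

theorem vertex_labels {r : Angle5 → Angle4} (hr : IsReduction r) :
    r .δ = .γ ∧ r .ε = .δ ∧ ∀ a : Angle5, a ≠ .δ → a ≠ .ε →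
      ({r a, r a.atVertex, r a.atVertex.atVertex} : Multiset Angle4) = {.α, .α, .β} := by
  rcases hr with rfl | rfl | rfl <;> decide

end IsReduction

/-- `{N α²βγδ : N α²β, k γ³, l δ^q}`. -/
def reducedAVC (N k l q : ℕ) : AVC Angle4 where
  numTiles := N
  tile := {.α, .α, .β, .γ, .δ}
  vertices := Multiset.replicate N {.α, .α, .β} + Multiset.replicate k {.γ, .γ, .γ} +
    Multiset.replicate l (Multiset.replicate q .δ)

theorem Angle5.vertexLabels_ne {q : ℕ} (hq : 2 ≤ q) :
    vertexLabels q .α ≠ vertexLabels q .δ ∧ vertexLabels q .α ≠ vertexLabels q .ε ∧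
      vertexLabels q .δ ≠ vertexLabels q .ε := by
  have hmem : Angle4.δ ∈ vertexLabels q .ε := by
    unfold vertexLabels
    rw [Multiset.mem_replicate]
    exact ⟨by omega, rfl⟩
  have h1 : Angle4.δ ∉ vertexLabels q .α :=
    (by decide : Angle4.δ ∉ ({.α, .α, .β} : Multiset Angle4))
  have h2 : Angle4.δ ∉ vertexLabels q .δ :=
    (by decide : Angle4.δ ∉ ({.γ, .γ, .γ} : Multiset Angle4))
  exact ⟨(by decide : ({.α, .α, .β} : Multiset Angle4) ≠ {.γ, .γ, .γ}), fun h => h1 (h ▸ hmem),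
    fun h => h2 (h ▸ hmem)⟩

theorem count_reducedAVC (N k l q : ℕ) (hq : 2 ≤ q) (m : Multiset Angle4) :
    (reducedAVC N k l q).vertices.count m =
      if m = Angle5.vertexLabels q .α then N else if m = Angle5.vertexLabels q .δ then k
      else if m = Angle5.vertexLabels q .ε then l else 0 := by
  obtain ⟨h12, h13, h23⟩ := Angle5.vertexLabels_ne hq
  have key : ∀ x y z : Multiset Angle4, x ≠ y → x ≠ z → y ≠ z →
      (Multiset.replicate N x + Multiset.replicate k y + Multiset.replicate l z).count m =
        if m = x then N else if m = y then k else if m = z then l else 0 := by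
    intro x y z hxy hxz hyz
    simp only [Multiset.count_add, Multiset.count_replicate]
    by_cases h1 : m = x
    · subst h1
      simp [hxy.symm, hxz.symm]
    by_cases h2 : m = y
    · subst h2
      simp [h1, hxy, hyz.symm]
    by_cases h3 : m = z
    · subst h3
      simp [hxz, hyz, hxz.symm, hyz.symm]
    · simp [h1, h2, h3, Ne.symm h1, Ne.symm h2, Ne.symm h3]
  exact key _ _ _ h12 h13 h23

/-! ### From the positions of the corners to a tiling. -/

namespace LabelledMap

variable {D D' : Type*}

/-- `pos` identifies the corners of `T` with the corners of the pentagonal subdivision of a map with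
`N` darts, tiles of degree `q` and vertices of degree three, with labels changed by `r`. -/
structure IsReducedBy (T : LabelledMap D Angle4) (r : Angle5 → Angle4) (q N : ℕ)
    (pos : D → Angle5) : Prop where
  connected : T.Connected
  card : Nat.card D = 5 * N
  label_eq : ∀ d, T.label d = r (pos d)
  pos_face : ∀ d, pos (T.face d) = (pos d).next
  pos_vertex : ∀ d, pos (T.vertex d) = (pos d).atVertex
  face_pow : ∀ d, (T.face ^ 5) d = d
  vertex_period : ∀ d, Function.minimalPeriod T.vertex d = (pos d).degree q

namespace IsReducedBy

variable {T : LabelledMap D Angle4} {r : Angle5 → Angle4} {q N : ℕ} {pos : D → Angle5}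

theorem pos_face_pow (h : T.IsReducedBy r q N pos) (n : ℕ) (d : D) :
    pos ((T.face ^ n) d) = Angle5.next^[n] (pos d) := by
  induction n with
  | zero => rfl
  | succ n ih =>
    rw [pow_succ', Equiv.Perm.mul_apply, h.pos_face, ih, Function.iterate_succ_apply']

theorem pos_vertex_pow (h : T.IsReducedBy r q N pos) (n : ℕ) (d : D) :
    pos ((T.vertex ^ n) d) = Angle5.atVertex^[n] (pos d) := by
  induction n with
  | zero => rfl
  | succ n ih =>
    rw [pow_succ', Equiv.Perm.mul_apply, h.pos_vertex, ih, Function.iterate_succ_apply']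

theorem pos_edge (h : T.IsReducedBy r q N pos) (d : D) :
    pos (T.edge d) = (pos d).atVertex.prev := by
  have h1 := h.pos_vertex d
  rw [SurfaceMap.vertex_apply, h.pos_face] at h1
  rw [← h1]
  cases pos (T.edge d) <;> rfl

theorem minimalPeriod_face (h : T.IsReducedBy r q N pos) (d : D) :
    Function.minimalPeriod T.face d = 5 := by
  have : Fact (Nat.Prime 5) := ⟨by norm_num⟩
  refine Function.minimalPeriod_eq_prime (p := 5) ?_ ?_
  · unfold Function.IsPeriodicPt Function.IsFixedPt
    rw [Equiv.Perm.iterate_eq_pow]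
    exact h.face_pow d
  · intro hd
    have := h.pos_face d
    rw [hd] at this
    revert this
    cases pos d <;> decide

theorem card_tile [Fintype D] (h : T.IsReducedBy r q N pos) : Nat.card T.Tile = N := by
  have h1 := card_eq_mul_card_cycles T.face 5 h.minimalPeriod_face
  exact Nat.eq_of_mul_eq_mul_left (by norm_num) (h1.symm.trans h.card)

theorem card_pos [Fintype D] (h : T.IsReducedBy r q N pos) (a : Angle5) :
    Nat.card {d // pos d = a} = N := by
  have hall : ∀ v, orbitLabels T.face pos v = {.α, .δ, .β, .γ, .ε} := by
    intro v
    induction v using Quotient.inductionOn with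
    | h d =>
      rw [orbitLabels_mk, h.minimalPeriod_face]
      simp only [h.pos_face_pow]
      cases pos d <;> decide
  rw [card_label_eq_count_mul T.face pos a _ fun d _ => hall _,
    Nat.card_congr (Equiv.subtypeUnivEquiv hall)]
  refine Eq.trans ?_ h.card_tile
  cases a <;> exact one_mul _

theorem card_label [Fintype D] (h : T.IsReducedBy r q N pos) (hr : IsReduction r) {x : Angle4}
    (hx : x ≠ .α) : Nat.card {d // T.label d = x} = N := by
  obtain ⟨a, ha⟩ := hr.exists_unique_corner x hx
  rw [← h.card_pos a]
  refine Nat.card_congr (Equiv.subtypeEquivRight fun d => ?_)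
  rw [h.label_eq, ha]

theorem labelsAt_mk [Fintype D] (h : T.IsReducedBy r q N pos) (hr : IsReduction r) (d : D) :
    T.labelsAt (Quotient.mk _ d) = (pos d).vertexLabels q := by
  obtain ⟨hδ, hε, hv⟩ := hr.vertex_labels
  rw [labelsAt_eq_orbitLabels, orbitLabels_mk, h.vertex_period]
  simp only [h.label_eq, h.pos_vertex_pow]
  have h3 : ∀ a : Angle5, (Multiset.range 3).map (fun i => r (Angle5.atVertex^[i] a)) =
      {r a, r a.atVertex, r a.atVertex.atVertex} := fun a => rfl
  cases hd : pos d
  case ε =>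
    have : ∀ i, r (Angle5.atVertex^[i] .ε) = .δ := by
      intro i
      rw [Function.iterate_fixed rfl, hε]
    simp only [this, Multiset.map_const', Multiset.card_range]
    rfl
  case δ =>
    refine (h3 _).trans ?_
    simp only [Angle5.atVertex, hδ]
    rfl
  all_goals exact (h3 _).trans (hv _ (by decide) (by decide))

/-- Positions show that a coincidence is only possible at `α`, `β`, `γ`, one or two turns around the
vertex. One turn would give an edge equal to its own reverse or a vertex of degree one; two turns
are one turn backwards, as the degree is three. -/
theorem not_sameCycle (h : T.IsReducedBy r q N pos) (hq : 2 ≤ q) [Finite D] (d : D) (k : ℕ)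
    (hk : 0 < k) (hk5 : k < 5) : ¬ T.vertex.SameCycle d ((T.face ^ k) d) := by
  rw [Equiv.Perm.sameCycle_iff_exists_lt_minimalPeriod]
  rintro ⟨i, hi, hik⟩
  have hfix : ∀ x, T.vertex x ≠ x := by
    intro x hx
    have h1 := h.vertex_period x
    rw [Function.minimalPeriod_eq_one_iff_isFixedPt.2 hx] at h1
    revert h1
    cases pos x <;> (simp [Angle5.degree]; try omega)
  have hfe : ∀ x, T.face x ≠ T.edge x := by
    intro x hx
    apply hfix (T.edge x)
    rw [T.vertex_edge, hx]
  have hpos := congrArg pos hik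
  rw [h.pos_vertex_pow, h.pos_face_pow] at hpos
  rw [h.vertex_period] at hi
  have h1 : ∀ x, T.vertex x ≠ T.face x := by
    intro x
    rw [SurfaceMap.vertex_apply]
    exact fun hx => T.edge_ne x (T.face.injective hx)
  have h2 : ∀ x, T.vertex x ≠ (T.face ^ 2) x := by
    intro x
    rw [SurfaceMap.vertex_apply]
    exact fun hx => hfe x (T.face.injective hx).symm
  have hsquare : pos d ≠ .δ → pos d ≠ .ε → i = 2 →
      T.vertex ((T.face ^ k) d) = (T.face ^ (5 - k)) ((T.face ^ k) d) := by
    rintro hδ hε rfl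
    rw [← Equiv.Perm.mul_apply (T.face ^ (5 - k)), ← pow_add, Nat.sub_add_cancel hk5.le,
      h.face_pow, ← hik, ← Equiv.Perm.mul_apply, ← pow_succ', ← Equiv.Perm.iterate_eq_pow]
    have h3 : Function.minimalPeriod T.vertex d = 3 := by
      rw [h.vertex_period]
      cases hp : pos d <;> first | rfl | exact absurd hp hδ | exact absurd hp hε
    change T.vertex^[3] d = d
    rw [← h3]
    exact Function.isPeriodicPt_minimalPeriod _ _
  have hne : ∀ (a : Angle5) (j : Fin 3) (n : Fin 5), 0 < (n : ℕ) →
      Angle5.atVertex^[j] a = Angle5.next^[n] a →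
      a ≠ .δ ∧ a ≠ .ε ∧ ((j : ℕ) = 1 ∧ ((n : ℕ) = 1 ∨ (n : ℕ) = 2) ∨
        (j : ℕ) = 2 ∧ ((n : ℕ) = 3 ∨ (n : ℕ) = 4)) := by
    decide
  have hi3 : i < 3 := by
    cases hp : pos d <;> rw [hp] at hi hpos
    case ε =>
      rw [Function.iterate_fixed rfl] at hpos
      exact absurd (hne .ε 0 ⟨k, hk5⟩ hk hpos).2.1 (by simp)
    all_goals exact hi
  obtain ⟨hδ, hε, ⟨rfl, rfl | rfl⟩ | ⟨rfl, rfl | rfl⟩⟩ := hne _ ⟨i, hi3⟩ ⟨k, hk5⟩ hk hpos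
  · exact h1 d hik
  · exact h2 d hik
  · exact h2 _ (hsquare hδ hε rfl)
  · exact h1 _ (hsquare hδ hε rfl)

/-- The three kinds of vertices are counted by their corners labelled β, γ and δ: one, three and `q`
at each vertex, and one of each label per tile. `hE` is Euler's formula for a base map with `k`
vertices, `N / 2` edges and `l` faces. -/
theorem isTilingFor [Fintype D] (h : T.IsReducedBy r q N pos) (hr : IsReduction r) {k l : ℕ}
    (hq : 2 ≤ q) (hk : N = 3 * k) (hl : N = q * l) (hE : 2 * (k + l) = N + 4) :
    T.IsTilingFor (reducedAVC N k l q) := by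
  obtain ⟨hrδ, hrε, -⟩ := hr.vertex_labels
  have hδ : ∀ d, T.label d = .γ → pos d = .δ := by
    intro d hd
    rw [h.label_eq] at hd
    obtain ⟨a, ha⟩ := hr.exists_unique_corner .γ (by decide)
    rw [(ha _).1 hd, (ha _).1 hrδ]
  have hε : ∀ d, T.label d = .δ → pos d = .ε := by
    intro d hd
    rw [h.label_eq] at hd
    obtain ⟨a, ha⟩ := hr.exists_unique_corner .δ (by decide)
    rw [(ha _).1 hd, (ha _).1 hrε]
  have hβ : ∀ d, T.label d = .β → (pos d).vertexLabels q = {.α, .α, .β} := by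
    intro d hd
    rw [h.label_eq] at hd
    cases hp : pos d <;> rw [hp] at hd
    case δ => rw [hrδ] at hd; cases hd
    case ε => rw [hrε] at hd; cases hd
    all_goals rfl
  have c1 : N = Nat.card {v : T.Vertex // T.labelsAt v = Angle5.vertexLabels q .α} := by
    have h1 := card_label_eq_count_mul T.vertex T.label .β {.α, .α, .β} fun d hd =>
      (h.labelsAt_mk hr d).trans (hβ d hd)
    rw [h.card_label hr (by decide)] at h1
    exact h1.trans (one_mul _)
  have c2 : k = Nat.card {v : T.Vertex // T.labelsAt v = Angle5.vertexLabels q .δ} := by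
    have h1 := card_label_eq_count_mul T.vertex T.label .γ {.γ, .γ, .γ} fun d hd =>
      (h.labelsAt_mk hr d).trans (by rw [hδ d hd]; rfl)
    rw [h.card_label hr (by decide), hk] at h1
    exact Nat.eq_of_mul_eq_mul_left (by norm_num) h1
  have c3 : l = Nat.card {v : T.Vertex // T.labelsAt v = Angle5.vertexLabels q .ε} := by
    have h1 := card_label_eq_count_mul T.vertex T.label .δ (Multiset.replicate q .δ) fun d hd =>
      (h.labelsAt_mk hr d).trans (by rw [hε d hd]; rfl)
    rw [h.card_label hr (by decide), Multiset.count_replicate_self, hl] at h1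
    exact Nat.eq_of_mul_eq_mul_left (by omega) h1
  have hcases : ∀ v : T.Vertex, T.labelsAt v = Angle5.vertexLabels q .α ∨
      T.labelsAt v = Angle5.vertexLabels q .δ ∨ T.labelsAt v = Angle5.vertexLabels q .ε := by
    intro v
    induction v using Quotient.inductionOn with
    | h d =>
      rw [h.labelsAt_mk hr]
      cases pos d <;> simp [Angle5.vertexLabels]
  have hcount : ∀ m, Nat.card {v : T.Vertex // T.labelsAt v = m} =
      (reducedAVC N k l q).vertices.count m := by
    intro m
    rw [count_reducedAVC _ _ _ _ hq]
    split_ifs with h1 h2 h3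
    · rw [h1, ← c1]
    · rw [h2, ← c2]
    · rw [h3, ← c3]
    · have : IsEmpty {v : T.Vertex // T.labelsAt v = m} := by
        refine ⟨fun v => ?_⟩
        have := hcases v.1
        rw [v.2] at this
        tauto
      exact Nat.card_of_isEmpty
  refine ⟨⟨h.connected, ?_⟩, fun d => ⟨h.minimalPeriod_face d, h.not_sameCycle hq d⟩, ?_,
    h.card_tile, hcount⟩
  -- With `5 * N` darts there are 5N/2 edges, and (N + k + l) - 5N/2 + N = 2 is equivalent to `hE`.
  · have hV : Nat.card T.Vertex = N + k + l := by
      classical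
      have hd : (Angle5.vertexLabels q .α ≠ Angle5.vertexLabels q .δ) ∧
          (Angle5.vertexLabels q .α ≠ Angle5.vertexLabels q .ε) ∧
          (Angle5.vertexLabels q .δ ≠ Angle5.vertexLabels q .ε) :=
        Angle5.vertexLabels_ne hq
      have h1 := Finset.card_eq_sum_card_fiberwise (s := (Finset.univ : Finset T.Vertex))
        (f := T.labelsAt) (t := {Angle5.vertexLabels q .α, Angle5.vertexLabels q .δ,
          Angle5.vertexLabels q .ε}) fun v _ => by simpa using hcases v
      rw [Finset.sum_insert (by simp [hd]), Finset.sum_insert (by simp [hd]),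
        Finset.sum_singleton] at h1
      simp only [Nat.card_eq_fintype_card, Fintype.card_subtype] at c1 c2 c3 ⊢
      rw [← Finset.card_univ, h1, ← c1, ← c2, ← c3, add_assoc]
    have hE2 := card_eq_mul_card_cycles T.edge 2 T.minimalPeriod_edge
    rw [h.card] at hE2
    rw [h.card_tile, hV]
    change 5 * N = 2 * Nat.card T.Edge at hE2
    omega
  · refine ⟨![r .α, r .δ, r .β, r .γ, r .ε], ?_, ?_⟩
    · refine Eq.trans ?_ hr.tile_labels
      change (Multiset.ofList [r .α, r .δ, r .β, r .γ, r .ε]) =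
        Multiset.ofList [r .α, r .β, r .γ, r .δ, r .ε]
      rw [Multiset.coe_eq_coe]
      exact .cons _ ((List.Perm.swap _ _ _).trans (.cons _ (List.Perm.swap _ _ _)))
    · intro d
      refine ⟨match pos d with | .α => 0 | .δ => 1 | .β => 2 | .γ => 3 | .ε => 4, Or.inl ?_⟩
      intro i
      rw [h.label_eq, h.pos_face_pow]
      cases pos d <;> fin_cases i <;> rfl

theorem of_orientedIso [Finite D] (h : T.IsReducedBy r q N pos) {T' : LabelledMap D' Angle4}
    (e : T'.OrientedIso T) : ∃ pos', T'.IsReducedBy r q N pos' := by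
  obtain ⟨e, hf, he, hl⟩ := e
  have hv : ∀ d, e (T'.vertex d) = T.vertex (e d) := by
    intro d
    rw [SurfaceMap.vertex_apply, hf, he]
    rfl
  have hit : ∀ (σ : Equiv.Perm D') (τ : Equiv.Perm D), (∀ d, e (σ d) = τ (e d)) →
      ∀ n d, e ((σ ^ n) d) = (τ ^ n) (e d) := by
    intro σ τ hστ n d
    induction n with
    | zero => rfl
    | succ n ih => rw [pow_succ', pow_succ', Equiv.Perm.mul_apply, Equiv.Perm.mul_apply, hστ, ih]
  refine ⟨pos ∘ e, ?_, (Nat.card_congr e).trans h.card, ?_, ?_, ?_, ?_, ?_⟩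
  · intro x y
    refine SurfaceMap.connected_of_induction x (fun P hPf hPe hx y => ?_) x y
    have := h.connected.induction (P := fun z => P (e.symm z)) ?_ ?_ (x := e x) (by simpa) (e y)
    · simpa using this
    · intro z hz
      have := hPf _ hz
      rwa [show T'.face (e.symm z) = e.symm (T.face z) by
        rw [Equiv.eq_symm_apply, hf, Equiv.apply_symm_apply]] at this
    · intro z hz
      have := hPe _ hz
      rwa [show T'.edge (e.symm z) = e.symm (T.edge z) by
        rw [Equiv.eq_symm_apply, he, Equiv.apply_symm_apply]] at this
  · intro d
    rw [← hl, h.label_eq]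
    rfl
  · intro d
    simp only [Function.comp_apply, hf, h.pos_face]
  · intro d
    simp only [Function.comp_apply, hv, h.pos_vertex]
  · intro d
    apply e.injective
    rw [hit _ _ hf, h.face_pow]
  · intro d
    rw [Function.comp_apply, ← h.vertex_period]
    refine Function.minimalPeriod_eq_minimalPeriod_iff.2 fun n => ?_
    unfold Function.IsPeriodicPt Function.IsFixedPt
    rw [Equiv.Perm.iterate_eq_pow, Equiv.Perm.iterate_eq_pow, ← hit _ _ hv, e.injective.eq_iff]

end IsReducedBy

end LabelledMap

/-! ### Arrangements of the labels in a tiling -/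

/-- The arrangement in which `α, δ, β, γ, ε` (in cyclic order) get the given labels. -/
def cornerLabels (x y z w v : Angle4) : Angle5 → Angle4
  | .α => x
  | .δ => y
  | .β => z
  | .γ => w
  | .ε => v

/-- Up to rotations and reflections, the arrangements of `α, α, β, γ, δ` that are not one of the
three reductions. -/
def IsOtherArrangement (r : Angle5 → Angle4) : Prop :=
  r = cornerLabels .α .α .β .γ .δ ∨ r = cornerLabels .α .α .β .δ .γ ∨
    r = cornerLabels .α .β .α .γ .δ

instance (r : Angle5 → Angle4) : Decidable (IsOtherArrangement r) :=
  inferInstanceAs (Decidable (_ ∨ _ ∨ _))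

/-- A corner of the pentagon together with an orientation of the tile. -/
abbrev OrientedCorner : Type := Bool × Angle5

namespace OrientedCorner

/-- The next corner counterclockwise, in a tile whose orientation may be reversed. -/
def fwd : OrientedCorner → OrientedCorner
  | (true, a) => (true, a.next)
  | (false, a) => (false, a.prev)

/-- The next corner clockwise, in a tile whose orientation may be reversed. -/
def bwd : OrientedCorner → OrientedCorner
  | (true, a) => (true, a.prev)
  | (false, a) => (false, a.next)

/-- The next corner at a vertex of a pentagonal subdivision or of its mirror image. -/
def around : OrientedCorner → OrientedCorner
  | (true, a) => (true, a.atVertex)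
  | (false, a) => (false, a.atVertex.atVertex)

theorem bwd_fwd : ∀ s, bwd (fwd s) = s := by decide

theorem fwd_five : ∀ s, fwd^[5] s = s := by decide

theorem around_three : ∀ s, around (around (around s)) = s := by decide

theorem fst_fwd : ∀ s, (fwd s).1 = s.1 := by decide

theorem fst_bwd : ∀ s, (bwd s).1 = s.1 := by decide

theorem fst_around : ∀ s, (around s).1 = s.1 := by decide

end OrientedCorner

open OrientedCorner in
theorem exists_arrangement : ∀ p : Fin 5 → Angle4,
    Finset.univ.val.map p = ({.α, .α, .β, .γ, .δ} : Multiset Angle4) →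
    ∃ r ∈ [reduction4A1, reduction4A2, reduction4A3, cornerLabels .α .α .β .γ .δ,
      cornerLabels .α .α .β .δ .γ, cornerLabels .α .β .α .γ .δ],
      ∃ s : OrientedCorner, ∀ i : Fin 5, p i = r (fwd^[i] s).2 := by
  decide +kernel

/-- Two labels that may be neighbours at a vertex. -/
def Angle4.Adjacent : Angle4 → Angle4 → Prop
  | α, α => True
  | α, β => True
  | β, α => True
  | γ, γ => True
  | δ, δ => True
  | _, _ => False

instance : DecidableRel Angle4.Adjacent := by
  rintro (_ | _ | _ | _) (_ | _ | _ | _) <;> unfold Angle4.Adjacent <;> infer_instance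

/-- Neighbouring corners at a vertex fit together at the other end of their common edge. -/
def FitsAround (r : Angle5 → Angle4) (s t : OrientedCorner) : Prop :=
  (r s.fwd.2).Adjacent (r t.bwd.2)

instance (r : Angle5 → Angle4) (s t : OrientedCorner) : Decidable (FitsAround r s t) :=
  inferInstanceAs (Decidable (Angle4.Adjacent _ _))

/-- In each reduction β is next to γ or δ in the pentagon. Such an edge at the vertex must face the
same label in a neighbouring α tile, which starts to pin down the positions and orientations; the
rest is a finite check. -/
theorem IsReduction.eq_around {r : Angle5 → Angle4} (hr : IsReduction r) :
    ∀ s t u : OrientedCorner, r s.2 = .β → r t.2 = .α → r u.2 = .α →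
      FitsAround r s t → FitsAround r t u → FitsAround r u s →
      t = s.around ∧ u = s.around.around := by
  rcases hr with rfl | rfl | rfl <;> decide +kernel

/-- In the first two arrangements β is next to γ (respectively δ), which no α is next to, so no α
fits along that edge. In the third, γ lies between α and δ, so the far ends of the edges at γ³ would
have to alternate between α and δ, impossible for three edges. -/
theorem IsOtherArrangement.not_fits {r : Angle5 → Angle4} (hr : IsOtherArrangement r) :
    (∀ s t u : OrientedCorner, r s.2 = .β → r t.2 = .α → r u.2 = .α →
      FitsAround r s t → FitsAround r t u → ¬ FitsAround r u s) ∨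
    (∀ s t u : OrientedCorner, r s.2 = .γ → r t.2 = .γ → r u.2 = .γ →
      FitsAround r s t → FitsAround r t u → ¬ FitsAround r u s) := by
  rcases hr with rfl | rfl | rfl
  · left; decide +kernel
  · left; decide +kernel
  · right; decide +kernel

/-- The labels β, γ, δ occur once each, while a nontrivial symmetry of the pentagon fixes at most
one corner; so the label sequence determines corner and orientation. -/
theorem orientedCorner_ext {r : Angle5 → Angle4} (hr : IsReduction r ∨ IsOtherArrangement r) :
    ∀ s t : OrientedCorner, (∀ i : Fin 5, r (OrientedCorner.fwd^[i] s).2 =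
      r (OrientedCorner.fwd^[i] t).2) → s = t := by
  rcases hr with (rfl | rfl | rfl) | (rfl | rfl | rfl) <;> decide +kernel

theorem SurfaceMap.vertex_three {D : Type*} {T : SurfaceMap D} {d : D}
    (hd : Function.minimalPeriod T.vertex d = 3) :
    T.vertex (T.vertex (T.vertex d)) = d := by
  change T.vertex^[3] d = d
  rw [← hd]
  exact Function.isPeriodicPt_minimalPeriod _ _

/-! ### From a tiling to the positions of the corners. -/

namespace LabelledMap

variable {D : Type*} [Fintype D] {T : LabelledMap D Angle4} {N k l q : ℕ}

namespace IsTilingFor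

theorem face_pow_five (h : T.IsTilingFor (reducedAVC N k l q)) (d : D) : (T.face ^ 5) d = d := by
  rw [← Equiv.Perm.iterate_eq_pow, ← (h.2.1 d).1]
  exact Function.isPeriodicPt_minimalPeriod _ _

theorem card_darts (h : T.IsTilingFor (reducedAVC N k l q)) : Nat.card D = 5 * N := by
  rw [card_eq_mul_card_cycles T.face 5 fun d => (h.2.1 d).1]
  exact congrArg _ h.2.2.2.1

theorem labelsAt_cases (h : T.IsTilingFor (reducedAVC N k l q)) (hq : 2 ≤ q) (v : T.Vertex) :
    T.labelsAt v = {.α, .α, .β} ∨ T.labelsAt v = {.γ, .γ, .γ} ∨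
      T.labelsAt v = Multiset.replicate q .δ := by
  have h1 := h.2.2.2.2 (T.labelsAt v)
  rw [count_reducedAVC _ _ _ _ hq] at h1
  by_contra! hne
  change T.labelsAt v ≠ Angle5.vertexLabels q .α ∧ T.labelsAt v ≠ Angle5.vertexLabels q .δ ∧
    T.labelsAt v ≠ Angle5.vertexLabels q .ε at hne
  rw [if_neg hne.1, if_neg hne.2.1, if_neg hne.2.2, Finite.card_eq_zero_iff] at h1
  exact h1.false ⟨v, rfl⟩

/-- The vertex at a corner with label `α` or `β`, or at a corner with label `γ`, or `δ`. -/
theorem vertex_cases (h : T.IsTilingFor (reducedAVC N k l q)) (hq : 2 ≤ q) (d : D) :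
    (Function.minimalPeriod T.vertex d = 3 ∧ ({T.label d, T.label (T.vertex d),
      T.label (T.vertex (T.vertex d))} : Multiset Angle4) = {.α, .α, .β}) ∨
    (Function.minimalPeriod T.vertex d = 3 ∧ T.label d = .γ ∧ T.label (T.vertex d) = .γ) ∨
    (Function.minimalPeriod T.vertex d = q ∧ T.label d = .δ ∧ T.label (T.vertex d) = .δ) := by
  have h1 := h.labelsAt_cases hq (Quotient.mk _ d)
  rw [labelsAt_eq_orbitLabels, orbitLabels_mk] at h1
  have hconst : ∀ x : Angle4, ∀ n, 2 ≤ n →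
      (Multiset.range (Function.minimalPeriod T.vertex d)).map
        (fun i => T.label ((T.vertex ^ i) d)) = Multiset.replicate n x →
      Function.minimalPeriod T.vertex d = n ∧ T.label d = x ∧ T.label (T.vertex d) = x := by
    intro x n hn h2
    have h3 := congrArg Multiset.card h2
    rw [Multiset.card_map, Multiset.card_range, Multiset.card_replicate] at h3
    have h4 : ∀ i < n, T.label ((T.vertex ^ i) d) = x := by
      intro i hi
      apply Multiset.eq_of_mem_replicate (n := n)
      rw [← h2]
      exact Multiset.mem_map_of_mem (fun i => T.label ((T.vertex ^ i) d))
        (Multiset.mem_range.2 (by omega))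
    -- The index 1 is in range because `2 ≤ n`.
    exact ⟨h3, h4 0 (by omega), h4 1 (by omega)⟩
  rcases h1 with h1 | h1 | h1
  · left
    have h3 := congrArg Multiset.card h1
    rw [Multiset.card_map, Multiset.card_range] at h3
    change _ = 3 at h3
    rw [h3] at h1
    refine ⟨h3, Eq.trans ?_ h1⟩
    rfl
  · exact Or.inr (Or.inl (hconst .γ 3 (by norm_num) h1))
  · exact Or.inr (Or.inr (hconst .δ q hq h1))

theorem adjacent (h : T.IsTilingFor (reducedAVC N k l q)) (hq : 2 ≤ q) (d : D) :
    (T.label d).Adjacent (T.label (T.vertex d)) := by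
  rcases h.vertex_cases hq d with ⟨-, h1⟩ | ⟨-, h1, h2⟩ | ⟨-, h1, h2⟩
  · revert h1
    generalize T.label d = x, T.label (T.vertex d) = y, T.label (T.vertex (T.vertex d)) = z
    revert x y z
    decide
  · rw [h1, h2]; decide
  · rw [h1, h2]; decide

theorem isReducedBy (h : T.IsTilingFor (reducedAVC N k l q)) (hq : 2 ≤ q) {r : Angle5 → Angle4}
    (hr : IsReduction r) {pos : D → Angle5} (hl : ∀ d, T.label d = r (pos d))
    (hf : ∀ d, pos (T.face d) = (pos d).next) (hv : ∀ d, pos (T.vertex d) = (pos d).atVertex) :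
    T.IsReducedBy r q N pos := by
  refine ⟨h.1.1, h.card_darts, hl, hf, hv, h.face_pow_five, fun d => ?_⟩
  have hinv : ∀ r, IsReduction r → ∀ a b c : Angle5,
      ((({r a, r b, r c} : Multiset Angle4) = {.α, .α, .β}) → a ≠ .δ ∧ a ≠ .ε) ∧
      (r a = .γ → a = .δ) ∧ (r a = .δ → a = .ε) := by
    rintro r (rfl | rfl | rfl) <;> decide
  have h1 := h.vertex_cases hq d
  rw [hl, hl, hl] at h1
  have h2 := hinv r hr (pos d) (pos (T.vertex d)) (pos (T.vertex (T.vertex d)))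
  rcases h1 with ⟨h1, h3⟩ | ⟨h1, h3, -⟩ | ⟨h1, h3, -⟩
  · have := h2.1 h3
    rw [h1]
    cases hp : pos d <;> simp_all [Angle5.degree]
  · rw [h1, h2.2.1 h3]; rfl
  · rw [h1, h2.2.2 h3]; rfl

theorem exists_orientedCorner (h : T.IsTilingFor (reducedAVC N k l q)) :
    ∃ r, (IsReduction r ∨ IsOtherArrangement r) ∧ ∃ st : D → OrientedCorner,
      (∀ d, T.label d = r (st d).2) ∧ ∀ d, st (T.face d) = (st d).fwd := by
  obtain ⟨-, -, ⟨p, hp, hT⟩, -⟩ := id h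
  obtain ⟨r, hr, s, hs⟩ := exists_arrangement p hp
  have hr' : IsReduction r ∨ IsOtherArrangement r := by
    simp only [List.mem_cons, List.not_mem_nil, or_false] at hr
    unfold IsReduction IsOtherArrangement
    tauto
  have hshift : ∀ (s : OrientedCorner) (c : Fin 5), ∃ t : OrientedCorner, ∀ i : Fin 5,
      OrientedCorner.fwd^[(c + i : Fin 5)] s = OrientedCorner.fwd^[i] t := by
    intro s c
    exact ⟨OrientedCorner.fwd^[c] s, by revert s c; decide⟩
  have hshift' : ∀ (s : OrientedCorner) (c : Fin 5), ∃ t : OrientedCorner, ∀ i : Fin 5,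
      (OrientedCorner.fwd^[(c - i : Fin 5)] s).2 = (OrientedCorner.fwd^[i] t).2 := by
    intro s c
    -- Reading the arrangement backwards amounts to flipping the orientation at the same corner.
    exact ⟨((!s.1), (OrientedCorner.fwd^[c] s).2), by revert s c; decide⟩
  have hex : ∀ d, ∃ t : OrientedCorner, ∀ i : Fin 5,
      T.label ((T.face ^ (i : ℕ)) d) = r (OrientedCorner.fwd^[i] t).2 := by
    intro d
    obtain ⟨c, hc | hc⟩ := hT d
    · obtain ⟨t, ht⟩ := hshift s c
      exact ⟨t, fun i => by rw [hc, hs, ht]⟩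
    · obtain ⟨t, ht⟩ := hshift' s c
      exact ⟨t, fun i => by rw [hc, hs, ht]⟩
  choose st hst using hex
  refine ⟨r, hr', st, fun d => hst d 0, fun d => ?_⟩
  apply orientedCorner_ext hr'
  intro i
  rw [← hst, ← Function.iterate_succ_apply, ← Equiv.Perm.mul_apply, ← pow_succ]
  obtain ⟨i, hi⟩ := i
  -- For `i = 4` the shifted index is 5, and both readings have returned to their start.
  by_cases hi4 : i = 4
  · subst hi4
    exact (congrArg T.label (h.face_pow_five d)).trans
      ((hst d 0).trans (by rw [OrientedCorner.fwd_five]; rfl))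
  · exact hst d ⟨i + 1, by omega⟩

theorem exists_isReducedBy (h : T.IsTilingFor (reducedAVC N k l q)) (hq : 2 ≤ q) (hN : N ≠ 0) :
    ∃ r, IsReduction r ∧ ∃ pos, T.IsReducedBy r q N pos ∨ T.mirror.IsReducedBy r q N pos := by
  obtain ⟨r, hr, st, hl, hf⟩ := h.exists_orientedCorner
  have he : ∀ d, st (T.edge d) = (st (T.vertex d)).bwd := by
    intro d
    rw [SurfaceMap.vertex_apply, hf, OrientedCorner.bwd_fwd]
  -- The corners at the other end of the edge of `d` are `edge d` and `face d`, neighbours because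
  -- `vertex (edge d) = face d`.
  have hfit : ∀ d, FitsAround r (st d) (st (T.vertex d)) := by
    intro d
    have h1 := h.adjacent hq (T.edge d)
    rw [T.vertex_edge, hl, hl, he, hf] at h1
    revert h1
    unfold FitsAround
    generalize r (st d).fwd.2 = x, r (st (T.vertex d)).bwd.2 = y
    revert x y
    decide
  have hfit3 : ∀ d, Function.minimalPeriod T.vertex d = 3 →
      FitsAround r (st (T.vertex (T.vertex d))) (st d) := by
    intro d hd
    have := hfit (T.vertex (T.vertex d))
    rwa [SurfaceMap.vertex_three hd] at this
  have hβ : ∀ d, T.label d = .β → Function.minimalPeriod T.vertex d = 3 ∧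
      T.label (T.vertex d) = .α ∧ T.label (T.vertex (T.vertex d)) = .α := by
    intro d hd
    rcases h.vertex_cases hq d with ⟨h1, h2⟩ | ⟨-, h1, -⟩ | ⟨-, h1, -⟩
    · refine ⟨h1, ?_⟩
      rw [hd] at h2
      revert h2
      generalize T.label (T.vertex d) = y, T.label (T.vertex (T.vertex d)) = z
      revert y z
      decide
    · rw [hd] at h1; cases h1
    · rw [hd] at h1; cases h1
  obtain ⟨d₀⟩ : Nonempty D := by
    by_contra hD
    rw [not_nonempty_iff] at hD
    have := h.card_darts
    rw [Nat.card_of_isEmpty] at this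
    omega
  have hpow : ∀ n d, st ((T.face ^ n) d) = OrientedCorner.fwd^[n] (st d) := by
    intro n d
    induction n with
    | zero => rfl
    | succ n ih => rw [pow_succ', Equiv.Perm.mul_apply, hf, ih, Function.iterate_succ_apply']
  rcases hr with hr | hr
  swap
  · have hex : ∀ r, IsOtherArrangement r → ∀ s : OrientedCorner,
        (∃ n : Fin 5, r (OrientedCorner.fwd^[n] s).2 = .β) ∧
        ∃ n : Fin 5, r (OrientedCorner.fwd^[n] s).2 = .γ := by
      rintro r (rfl | rfl | rfl) <;> decide
    obtain ⟨⟨i, hi⟩, ⟨j, hj⟩⟩ := hex r hr (st d₀)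
    rw [← hpow, ← hl] at hi hj
    exfalso
    rcases hr.not_fits with hn | hn
    · obtain ⟨h1, h2, h3⟩ := hβ _ hi
      rw [hl] at hi h2 h3
      exact hn _ _ _ hi h2 h3 (hfit _) (hfit _) (hfit3 _ h1)
    · obtain ⟨h1, h2⟩ : Function.minimalPeriod T.vertex ((T.face ^ (j : ℕ)) d₀) = 3 ∧
          T.label (T.vertex ((T.face ^ (j : ℕ)) d₀)) = .γ := by
        rcases h.vertex_cases hq ((T.face ^ (j : ℕ)) d₀) with ⟨-, h1⟩ | ⟨h1, -, h2⟩ | ⟨-, h1, -⟩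
        · rw [hj] at h1
          have : Angle4.γ ∈ ({.α, .α, .β} : Multiset Angle4) := by rw [← h1]; simp
          exact absurd this (by decide)
        · exact ⟨h1, h2⟩
        · rw [hj] at h1; cases h1
      have h3 : T.label (T.vertex (T.vertex ((T.face ^ (j : ℕ)) d₀))) = .γ := by
        have := h.adjacent hq (T.vertex ((T.face ^ (j : ℕ)) d₀))
        rw [h2] at this
        revert this
        generalize T.label _ = x
        revert x
        decide
      rw [hl] at hj h2 h3
      exact hn _ _ _ hj h2 h3 (hfit _) (hfit _) (hfit3 _ h1)
  have haround : ∀ d, T.label d = .β → st (T.vertex d) = (st d).around ∧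
      st (T.vertex (T.vertex d)) = (st d).around.around := by
    intro d hd
    obtain ⟨h1, h2, h3⟩ := hβ _ hd
    rw [hl] at hd h2 h3
    exact hr.eq_around _ _ _ hd h2 h3 (hfit _) (hfit _) (hfit3 _ h1)
  have haround' : ∀ d, T.label d = .α ∨ T.label d = .β → st (T.vertex d) = (st d).around := by
    rintro d (hd | hd)
    · rcases h.vertex_cases hq d with ⟨h1, h2⟩ | ⟨-, h1, -⟩ | ⟨-, h1, -⟩
      -- A corner labelled α is one or two turns away from the β of its vertex, where `haround`
      -- applies.
      · have h3 : T.label (T.vertex d) = .β ∨ T.label (T.vertex (T.vertex d)) = .β := by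
          rw [hd] at h2
          revert h2
          generalize T.label (T.vertex d) = y, T.label (T.vertex (T.vertex d)) = z
          revert y z
          decide
        rcases h3 with h3 | h3
        · have h4 := (haround _ h3).2
          rw [SurfaceMap.vertex_three h1] at h4
          rw [h4, OrientedCorner.around_three]
        · obtain ⟨h4, h5⟩ := haround _ h3
          rw [SurfaceMap.vertex_three h1] at h4 h5
          rw [h5, h4]
      · rw [hd] at h1; cases h1
      · rw [hd] at h1; cases h1
    · exact (haround d hd).1
  -- A γ or δ corner is followed by α or β, and its label occurs only once in the pentagon, so the
  -- orientation and the label determine the position.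
  have hnext : ∀ r, IsReduction r → ∀ s : OrientedCorner, ¬ (r s.2 = .α ∨ r s.2 = .β) →
      (r s.fwd.2 = .α ∨ r s.fwd.2 = .β) ∧ s.around = s ∧ ∀ t : OrientedCorner, t.1 = s.1 →
        (r s.2).Adjacent (r t.2) → t = s := by
    rintro r (rfl | rfl | rfl) <;> decide
  -- Orientations agree across each edge: at least one of its ends is of type α²β, where `haround'`
  -- compares the two tiles.
  have hoe : ∀ d, (st (T.edge d)).1 = (st d).1 := by
    intro d
    by_cases hd : T.label d = .α ∨ T.label d = .β
    · rw [he, haround' d hd, OrientedCorner.fst_bwd, OrientedCorner.fst_around]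
    · rw [hl] at hd
      have h1 := (hnext r hr _ hd).1
      rw [← hf, ← hl, ← T.vertex_edge] at h1
      have h2 : T.label (T.edge d) = .α ∨ T.label (T.edge d) = .β := by
        have := h.adjacent hq (T.edge d)
        revert this h1
        generalize T.label (T.edge d) = x, T.label (T.vertex (T.edge d)) = y
        revert x y
        decide
      have h3 := haround' _ h2
      rw [T.vertex_edge, hf] at h3
      rw [← OrientedCorner.fst_around, ← h3, OrientedCorner.fst_fwd]
  have hov : ∀ d, (st (T.vertex d)).1 = (st d).1 := by
    intro d
    rw [SurfaceMap.vertex_apply, hf, OrientedCorner.fst_fwd, hoe]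
  have hall : ∀ d, st (T.vertex d) = (st d).around := by
    intro d
    by_cases hd : T.label d = .α ∨ T.label d = .β
    · exact haround' d hd
    · have hd' := hd
      rw [hl] at hd'
      obtain ⟨-, h1, h2⟩ := hnext r hr _ hd'
      rw [h1]
      apply h2 _ (hov d)
      rw [← hl, ← hl]
      exact h.adjacent hq d
  have ho : ∀ d, (st d).1 = (st d₀).1 := by
    refine h.1.1.induction (P := fun d => (st d).1 = (st d₀).1) ?_ ?_ rfl
    · intro d hd
      rw [hf, OrientedCorner.fst_fwd, hd]
    · intro d hd
      rw [hoe, hd]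
  refine ⟨r, hr, fun d => (st d).2, ?_⟩
  cases ho₀ : (st d₀).1
  · right
    -- If all tiles are reversed, `fwd` and `around` act on positions as the inverses of `next` and
    -- `atVertex`, which the mirror image undoes.
    have hneg : ∀ s : OrientedCorner, s.1 = false →
        s.2 = s.fwd.2.next ∧ s.2 = s.around.2.atVertex := by decide
    refine h.mirror.isReducedBy hq hr hl (fun d => ?_) (fun d => ?_)
    · change (st (T.face⁻¹ d)).2 = _
      rw [(hneg _ ((ho (T.face⁻¹ d)).trans ho₀)).1, ← hf, show T.face (T.face⁻¹ d) = d from T.face.apply_symm_apply d]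
    · have h1 : T.mirror.vertex d = T.vertex⁻¹ d :=
        congrArg (fun σ : Equiv.Perm D => σ d) T.toSurfaceMap.mirror_vertex
      rw [h1, (hneg _ ((ho (T.vertex⁻¹ d)).trans ho₀)).2, ← hall,
        show T.vertex (T.vertex⁻¹ d) = d from T.vertex.apply_symm_apply d]
  · left
    have hpos : ∀ s : OrientedCorner, s.1 = true →
        s.fwd.2 = s.2.next ∧ s.around.2 = s.2.atVertex := by decide
    refine h.isReducedBy hq hr hl (fun d => ?_) (fun d => ?_)
    · rw [hf, (hpos _ ((ho d).trans ho₀)).1]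
    · rw [hall, (hpos _ ((ho d).trans ho₀)).2]

end IsTilingFor

end LabelledMap

/-! ### Maps determined by the degrees of their tiles and vertices -/

namespace SurfaceMap

universe u

variable {D : Type*}

/-- Any action of the triangle group `⟨F, E | F ^ q, E ^ 2, (F E) ^ 3⟩` on a nonempty type admits
an equivariant map from the darts of `M`. -/
def IsUniversal (M : SurfaceMap D) (q : ℕ) : Prop :=
  ∀ (B : Type u) (F E : B → B), (∀ b, F^[q] b = b) → (∀ b, E (E b) = b) →
    (∀ b, F (E (F (E (F (E b))))) = b) → B →
    ∃ φ : D → B, (∀ x, φ (M.face x) = F (φ x)) ∧ ∀ x, φ (M.edge x) = E (φ x)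

/-- One step in the propagation of compatibility with `edge`: along edges, and from two of the edges
at a vertex of degree three to the third one. -/
def propagate [Fintype D] [DecidableEq D] (M : SurfaceMap D) (S : Finset D) : Finset D :=
  Finset.univ.filter fun x =>
    x ∈ S ∨ M.edge x ∈ S ∨ (M.vertex x ∈ S ∧ M.vertex (M.vertex x) ∈ S)

/-- If two edges at a vertex of degree three are respected, going once around the vertex and using
(FE)³ = 1 forces the third. -/
theorem edge_equivariant_of_propagate [Fintype D] [DecidableEq D] {M : SurfaceMap D}
    (hv : ∀ x, (M.vertex ^ 3) x = x) {B : Type*} {F E : B → B} (hE : ∀ b, E (E b) = b)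
    (hFE : ∀ b, F (E (F (E (F (E b))))) = b) {φ : D → B}
    (hφ : ∀ x, φ (M.face x) = F (φ x))
    {S : Finset D} (hS : ∀ x ∈ S, φ (M.edge x) = E (φ x)) (n : ℕ) :
    ∀ x ∈ M.propagate^[n] S, φ (M.edge x) = E (φ x) := by
  induction n with
  | zero => exact hS
  | succ n ih =>
    intro x hx
    rw [Function.iterate_succ_apply'] at hx
    simp only [propagate, Finset.mem_filter, Finset.mem_univ, true_and] at hx
    rcases hx with hx | hx | ⟨h1, h2⟩
    · exact ih x hx
    · have := ih _ hx
      rw [M.edge_edge] at this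
      rw [this, hE]
    · have h3 := hv x
      have hvφ : ∀ y, φ (M.edge y) = E (φ y) → φ (M.vertex y) = F (E (φ y)) := by
        intro y hy
        rw [vertex_apply, hφ, hy]
      have h4 := hvφ _ (ih _ h2)
      rw [hvφ _ (ih _ h1)] at h4
      have h5 : M.vertex (M.vertex (M.vertex x)) = x := h3
      rw [h5, vertex_apply, hφ] at h4
      have h6 := hFE (E (φ (M.edge x)))
      rw [hE, ← h4] at h6
      rw [h6, hE]

variable {ι : Type*} {n : ℕ} [NeZero n]

/-- The paths form a spanning tree of the faces rooted at `i₀`, with face `i` entered through its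
dart `(i, 0)`. They prescribe the image of one dart of each face, and `F^[q] b = b` extends this
around the face. Tree edges are respected by construction, and `hm` says that the vertex relations
then reach all remaining edges. -/
theorem isUniversal_of_paths [Fintype ι] [DecidableEq ι] {M : SurfaceMap (ι × Fin n)}
    (hface : ∀ i k, M.face (i, k) = (i, k + 1)) (hv : ∀ x, (M.vertex ^ 3) x = x) (i₀ : ι)
    (path : ι → List ℕ)
    (hpath : ∀ i, i ≠ i₀ →
      path i = path (M.edge (i, 0)).1 ++ [((M.edge (i, 0)).2 : ℕ)]) (m : ℕ)
    (hm : M.propagate^[m] (Finset.univ.filter fun x => x.1 ≠ i₀ ∧ x.2 = 0) = Finset.univ) :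
    M.IsUniversal n := by
  intro B F E hF hE hFE b₀
  set base : ι → B := fun i => (path i).foldl (fun b k => E (F^[k] b)) b₀ with hbase
  set φ : ι × Fin n → B := fun x => F^[x.2] (base x.1) with hφ
  have hface' : ∀ x, φ (M.face x) = F (φ x) := by
    rintro ⟨i, k⟩
    rw [hface]
    simp only [hφ]
    have h1 : ((k + 1 : Fin n) : ℕ) = (k + 1) % n := by simp [Fin.val_add]
    rw [← Function.iterate_succ_apply' F, h1]
    exact Function.IsPeriodicPt.iterate_mod_apply (hF (base i)) _
  refine ⟨φ, hface', fun x => ?_⟩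
  refine edge_equivariant_of_propagate hv hE hFE hface' ?_ m x (hm ▸ Finset.mem_univ x)
  · rintro ⟨i, k⟩ hx
    simp only [Finset.mem_filter, Finset.mem_univ, true_and] at hx
    obtain ⟨hi, rfl⟩ := hx
    simp only [hφ, hbase]
    rw [hpath i hi, List.foldl_append]
    simp [hE]

theorem connected_of_paths {M : SurfaceMap (ι × Fin n)}
    (hface : ∀ i k, M.face (i, k) = (i, k + 1)) (i₀ : ι) (path : ι → List ℕ)
    (hpath : ∀ i, (path i).foldl (fun x k => M.edge (M.face^[k] x)) (i₀, 0) = (i, 0)) :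
    M.Connected := by
  refine connected_of_induction (i₀, 0) fun P hf he h₀ => ?_
  have hpow : ∀ k x, P x → P (M.face^[k] x) := by
    intro k
    induction k with
    | zero => exact fun x hx => hx
    | succ k ih => exact fun x hx => ih _ (hf x hx)
  have hfold : ∀ (l : List ℕ) x, P x → P (l.foldl (fun x k => M.edge (M.face^[k] x)) x) := by
    intro l
    induction l with
    | nil => exact fun x hx => hx
    | cons k l ih => exact fun x hx => ih _ (he _ (hpow k x hx))
  rintro ⟨i, k⟩
  have h1 : ∀ k, M.face^[k] (i, 0) = (i, Fin.ofNat n k) := by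
    intro k
    induction k with
    | zero => rfl
    | succ k ih =>
      rw [Function.iterate_succ_apply', ih, hface]
      congr 1
      ext
      simp [Fin.val_add]
  have h2 := hpow k _ (hfold (path i) _ h₀)
  rwa [hpath, h1, show Fin.ofNat n k = k from Fin.ext (Nat.mod_eq_of_lt k.2)] at h2

end SurfaceMap

/-- For each face of the cube, the turns on a path to it from the first face. -/
def cubePath : Fin 6 → List ℕ :=
  ![[], [3, 2], [3], [3, 3, 2], [3, 3], [2]]

/-- For each face of the dodecahedron, the turns on a path to it from the first face. -/
def dodecahedronPath : Fin 12 → List ℕ :=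
  ![[], [0], [1], [2], [3], [4], [1, 2], [2, 2], [3, 2], [4, 2], [0, 2], [4, 2, 3]]

/-! ### Finite checks for the cube and the dodecahedron. -/

theorem cube_isUniversal : cube.IsUniversal 4 :=
  SurfaceMap.isUniversal_of_paths (fun _ _ => rfl) (by decide +kernel) 0 cubePath
    (by decide +kernel) 8 (by decide +kernel)

theorem dodecahedron_isUniversal : dodecahedron.IsUniversal 5 :=
  SurfaceMap.isUniversal_of_paths (fun _ _ => rfl) (by decide +kernel) 0 dodecahedronPath
    (by decide +kernel) 20 (by decide +kernel)

theorem cube_connected : cube.Connected :=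
  SurfaceMap.connected_of_paths (fun _ _ => rfl) 0 cubePath (by decide +kernel)

theorem dodecahedron_connected : dodecahedron.Connected :=
  SurfaceMap.connected_of_paths (fun _ _ => rfl) 0 dodecahedronPath (by decide +kernel)

theorem cube_vertex_period (d : Fin 6 × Fin 4) : Function.minimalPeriod cube.vertex d = 3 :=
  Function.minimalPeriod_eq_prime (p := 3)
    ((by decide +kernel : ∀ d, (cube.vertex ^ 3) d = d) d)
    ((by decide +kernel : ∀ d, cube.vertex d ≠ d) d)

theorem dodecahedron_vertex_period (d : Fin 12 × Fin 5) :
    Function.minimalPeriod dodecahedron.vertex d = 3 :=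
  Function.minimalPeriod_eq_prime (p := 3)
    ((by decide +kernel : ∀ d, (dodecahedron.vertex ^ 3) d = d) d)
    ((by decide +kernel : ∀ d, dodecahedron.vertex d ≠ d) d)

theorem cube_face_period (d : Fin 6 × Fin 4) : Function.minimalPeriod cube.face d = 4 :=
  Function.minimalPeriod_eq_prime_pow (p := 2) (k := 1)
    ((by decide +kernel : ∀ d, ¬ (cube.face ^ 2) d = d) d)
    ((by decide +kernel : ∀ d, (cube.face ^ 4) d = d) d)

theorem dodecahedron_face_period (d : Fin 12 × Fin 5) :
    Function.minimalPeriod dodecahedron.face d = 5 :=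
  have : Fact (Nat.Prime 5) := ⟨by norm_num⟩
  Function.minimalPeriod_eq_prime (p := 5)
    ((by decide +kernel : ∀ d, (dodecahedron.face ^ 5) d = d) d)
    ((by decide +kernel : ∀ d, dodecahedron.face d ≠ d) d)

/-! ### Pentagonal subdivisions and their reductions -/

namespace SurfaceMap

variable {D : Type*} (M : SurfaceMap D)

theorem pentagonalSubdivision_vertex (d : D) (a : Angle5) :
    M.pentagonalSubdivision.vertex (d, a) =
      match a with
      | .α => (M.edge (M.face⁻¹ d), .β)
      | .δ => (M.vertex d, .δ)
      | .β => (M.edge d, .γ)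
      | .γ => (M.face d, .α)
      | .ε => (M.face⁻¹ d, .ε) := by
  cases a <;> rfl

theorem pentagonalSubdivision_vertex_pow_δ (n : ℕ) (d : D) :
    M.pentagonalSubdivision.vertex^[n] (d, .δ) = (M.vertex^[n] d, .δ) := by
  induction n with
  | zero => rfl
  | succ n ih =>
    rw [Function.iterate_succ_apply', ih, Function.iterate_succ_apply']
    rfl

theorem pentagonalSubdivision_vertex_pow_ε (n : ℕ) (d : D) :
    M.pentagonalSubdivision.vertex^[n] (d, .ε) = ((M.face⁻¹ : Equiv.Perm D)^[n] d, .ε) := by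
  induction n with
  | zero => rfl
  | succ n ih =>
    rw [Function.iterate_succ_apply', ih, Function.iterate_succ_apply']
    rfl

theorem Connected.pentagonalSubdivision [Finite D] {M : SurfaceMap D} (h : M.Connected) :
    M.pentagonalSubdivision.Connected := by
  rintro x y
  refine connected_of_induction x (fun P hf he hx y => ?_) x y
  have hδ : ∀ d, P (d, .δ) → ∀ a, P (d, a) := by
    intro d h1
    have h2 : P (d, .β) := hf _ h1
    have h3 : P (d, .γ) := hf _ h2
    have h4 : P (d, .ε) := hf _ h3
    have h5 : P (d, .α) := hf _ h4
    rintro (_ | _ | _ | _ | _) <;> assumption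
  have hall : ∀ d a, P (d, a) → P (d, .δ) := by
    intro d a h1
    cases a
    case α => exact hf _ h1
    case ε => exact hf _ (hf _ h1)
    case γ => exact hf _ (hf _ (hf _ h1))
    case β => exact hf _ (hf _ (hf _ (hf _ h1)))
    case δ => exact h1
  have key := h.induction (P := fun d => P (d, .δ)) (x := x.1) ?_ ?_ (hall _ _ hx) y.1
  · exact hδ _ key y.2
  · intro d hd
    exact hall _ .ε (he _ (hδ d hd .γ))
  · intro d hd
    exact hall _ .β (he _ (hδ d hd .β))

theorem pentagonalSubdivision_isReducedBy [Fintype D] {M : SurfaceMap D} {q N : ℕ}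
    (hc : M.Connected) (hN : Nat.card D = N)
    (hv : ∀ d, Function.minimalPeriod M.vertex d = 3)
    (hf : ∀ d, Function.minimalPeriod M.face d = q) (r : Angle5 → Angle4) :
    (M.pentagonalSubdivision.relabel r).IsReducedBy r q N Prod.snd where
  connected := hc.pentagonalSubdivision
  card := by
    rw [Nat.card_prod, hN, Nat.card_eq_fintype_card (α := Angle5), mul_comm]
    rfl
  label_eq _ := rfl
  pos_face _ := rfl
  pos_vertex := by rintro ⟨d, _ | _ | _ | _ | _⟩ <;> rfl
  face_pow := by rintro ⟨d, _ | _ | _ | _ | _⟩ <;> rfl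
  vertex_period := by
    rintro ⟨d, a⟩
    change Function.minimalPeriod M.pentagonalSubdivision.vertex (d, a) = a.degree q
    cases a
    case δ =>
      refine Eq.trans ?_ (hv d)
      refine Function.minimalPeriod_eq_minimalPeriod_iff.2 fun n => ?_
      unfold Function.IsPeriodicPt Function.IsFixedPt
      rw [pentagonalSubdivision_vertex_pow_δ]
      simp
    case ε =>
      refine Eq.trans ?_ ((M.face.minimalPeriod_inv d).trans (hf d))
      refine Function.minimalPeriod_eq_minimalPeriod_iff.2 fun n => ?_
      unfold Function.IsPeriodicPt Function.IsFixedPt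
      rw [pentagonalSubdivision_vertex_pow_ε]
      simp
    all_goals
      refine Function.minimalPeriod_eq_prime (p := 3) ?_ ?_
      · change M.pentagonalSubdivision.vertex (M.pentagonalSubdivision.vertex
          (M.pentagonalSubdivision.vertex _)) = _
        simp [pentagonalSubdivision_vertex, M.edge_edge]
      · intro h
        have h1 := congrArg Prod.snd h
        rw [pentagonalSubdivision_vertex] at h1
        cases h1

end SurfaceMap

/-! ### Recovering the base polyhedron. -/

namespace LabelledMap.IsReducedBy

universe u

variable {D₀ : Type*} [Fintype D₀] {D : Type u} [Fintype D] {T : LabelledMap D Angle4}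
  {r : Angle5 → Angle4} {q N : ℕ} {pos : D → Angle5}

/-- The corners at position `δ` play the role of the darts of the base map, and universality
compares them with the darts of `M`. -/
theorem orientedIso (h : T.IsReducedBy r q N pos) (hN : N ≠ 0) {M : SurfaceMap D₀}
    (hcard : Nat.card D₀ = N) (hM : SurfaceMap.IsUniversal.{u} M q) :
    T.OrientedIso (M.pentagonalSubdivision.relabel r) := by
  have f5 : ∀ d, T.face (T.face (T.face (T.face (T.face d)))) = d := h.face_pow
  have hp := h.pos_face
  have hpe := h.pos_edge
  have hee := T.edge_edge
  have hv3 : ∀ d, pos d ≠ .ε → T.vertex (T.vertex (T.vertex d)) = d := by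
    intro d hd
    apply SurfaceMap.vertex_three
    rw [h.vertex_period]
    cases hx : pos d <;> first | rfl | exact absurd hx hd
  let B : Type u := {d : D // pos d = .δ}
  -- `F` crosses the edge from `γ` to the centre of the face, reaching the next tile around that
  -- centre; `E`, below, crosses the middle segment from `β` to `γ`.
  let F : B → B := fun b => ⟨T.face (T.face (T.edge (T.face (T.face b.1)))), by
    rw [hp, hp, hpe, hp, hp, b.2]; rfl⟩
  let E : B → B := fun b => ⟨T.face (T.face (T.face (T.face (T.edge (T.face b.1))))), by
    rw [hp, hp, hp, hp, hpe, hp, b.2]; rfl⟩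
  have hEE : ∀ b, E (E b) = b := by
    intro b
    apply Subtype.ext
    simp only [E, f5, hee]
  -- This is the degree three condition at the point of position `β`, inside an edge of the base
  -- map.
  have hFE : ∀ b : B, (F (E b)).1 = T.vertex b.1 := by
    intro b
    have h1 := hv3 (T.face b.1) (by rw [hp, b.2]; decide)
    simp only [SurfaceMap.vertex_apply] at h1
    have h2 := congrArg T.edge (T.face.injective h1)
    rw [hee] at h2
    simp only [F, E, f5, SurfaceMap.vertex_apply]
    exact congrArg T.face h2
  have hFE3 : ∀ b, F (E (F (E (F (E b))))) = b := by
    intro b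
    apply Subtype.ext
    rw [hFE, hFE, hFE]
    exact hv3 _ (by rw [b.2]; decide)
  have hFq : ∀ b, F^[q] b = b := by
    intro b
    -- Three steps from `δ` lead to the corner `ε`. There `F` is one turn backwards around the
    -- vertex of degree `q`, whence `F^[q] b = b`.
    have h1 : ∀ b : B, T.vertex (T.face (T.face (T.face (F b).1))) =
        T.face (T.face (T.face b.1)) := by
      intro b
      simp only [F, f5, SurfaceMap.vertex_apply, hee]
    have h2 : ∀ n, T.vertex^[n] (T.face (T.face (T.face (F^[n] b).1))) =
        T.face (T.face (T.face b.1)) := by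
      intro n
      induction n with
      | zero => rfl
      | succ n ih =>
        rw [Function.iterate_succ_apply, Function.iterate_succ_apply' F, h1, ih]
    have h3 := h2 q
    have h4 : T.vertex^[q] (T.face (T.face (T.face (F^[q] b).1))) =
        T.face (T.face (T.face (F^[q] b).1)) := by
      have h5 : Function.minimalPeriod T.vertex (T.face (T.face (T.face (F^[q] b).1))) = q := by
        rw [h.vertex_period, hp, hp, hp, (F^[q] b).2]
        rfl
      have h6 := Function.isPeriodicPt_minimalPeriod T.vertex
        (T.face (T.face (T.face (F^[q] b).1)))
      rwa [h5] at h6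
    rw [h4] at h3
    exact Subtype.ext (T.face.injective (T.face.injective (T.face.injective h3)))
  obtain ⟨b₀⟩ : Nonempty B := by
    by_contra hB
    rw [not_nonempty_iff] at hB
    have h1 := h.card_pos .δ
    have h2 : Nat.card B = 0 := Nat.card_of_isEmpty
    exact hN (h1.symm.trans h2)
  obtain ⟨φ, hφF, hφE⟩ := hM B F E hFq hEE hFE3 b₀
  let Φ : D₀ × Angle5 → D
    | (x, .δ) => (φ x).1
    | (x, .β) => T.face (φ x).1
    | (x, .γ) => T.face (T.face (φ x).1)
    | (x, .ε) => T.face (T.face (T.face (φ x).1))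
    | (x, .α) => T.face (T.face (T.face (T.face (φ x).1)))
  have hΦf : ∀ y, Φ (M.pentagonalSubdivision.face y) = T.face (Φ y) := by
    rintro ⟨x, _ | _ | _ | _ | _⟩
    case α => exact (f5 _).symm
    all_goals rfl
  have hδ : ∀ x, Φ (M.pentagonalSubdivision.edge (x, .δ)) = T.edge (Φ (x, .δ)) := by
    intro x
    change T.face (T.face (T.face (T.face (φ (M.face (M.edge x))).1))) = T.edge (φ x).1
    rw [hφF, hφE, hFE, SurfaceMap.vertex_apply, f5]
  have hγ : ∀ x, Φ (M.pentagonalSubdivision.edge (x, .γ)) = T.edge (Φ (x, .γ)) := by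
    intro x
    change T.face (T.face (T.face (φ (M.face x)).1)) = T.edge (T.face (T.face (φ x).1))
    rw [hφF]
    simp only [F, f5]
  -- Compatibility along an edge passes to the reversed dart, so the positions `α` and `ε` follow
  -- from `δ` and `γ`.
  have hinv : ∀ y, Φ (M.pentagonalSubdivision.edge y) = T.edge (Φ y) →
      Φ (M.pentagonalSubdivision.edge (M.pentagonalSubdivision.edge y)) =
        T.edge (Φ (M.pentagonalSubdivision.edge y)) := by
    intro y hy
    rw [hy, hee, M.pentagonalSubdivision.edge_edge]
  have hΦe : ∀ y, Φ (M.pentagonalSubdivision.edge y) = T.edge (Φ y) := by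
    rintro ⟨x, _ | _ | _ | _ | _⟩
    case δ => exact hδ x
    case γ => exact hγ x
    case β =>
      change T.face (φ (M.edge x)).1 = T.edge (T.face (φ x).1)
      rw [hφE]
      simp only [E, f5]
    case α =>
      have h1 := hinv (M.edge (M.face⁻¹ x), .δ) (hδ _)
      have h2 : M.pentagonalSubdivision.edge (M.edge (M.face⁻¹ x), .δ) = (x, .α) := by
        change (M.face (M.edge (M.edge (M.face⁻¹ x))), Angle5.α) = _
        rw [M.edge_edge, show M.face (M.face⁻¹ x) = x from M.face.apply_symm_apply x]
      rwa [h2] at h1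
    case ε =>
      have h1 := hinv (M.face⁻¹ x, .γ) (hγ _)
      have h2 : M.pentagonalSubdivision.edge (M.face⁻¹ x, .γ) = (x, .ε) := by
        change (M.face (M.face⁻¹ x), Angle5.ε) = _
        rw [show M.face (M.face⁻¹ x) = x from M.face.apply_symm_apply x]
      rwa [h2] at h1
  have hpos : ∀ y, pos (Φ y) = y.2 := by
    rintro ⟨x, _ | _ | _ | _ | _⟩ <;> simp only [Φ, hp, (φ x).2] <;> rfl
  -- The image is nonempty and closed under `face` and `edge`, and `T` is connected.
  have hsurj : Function.Surjective Φ := by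
    obtain ⟨x₀⟩ : Nonempty D₀ := by
      by_contra hD
      rw [not_nonempty_iff] at hD
      rw [Nat.card_of_isEmpty] at hcard
      exact hN hcard.symm
    refine h.connected.induction (P := fun d => ∃ y, Φ y = d) ?_ ?_ (x := Φ (x₀, .δ)) ⟨(x₀, .δ), rfl⟩
    · rintro _ ⟨y, rfl⟩
      exact ⟨_, hΦf y⟩
    · rintro _ ⟨y, rfl⟩
      exact ⟨_, hΦe y⟩
  have hbij : Function.Bijective Φ := by
    refine hsurj.bijective_of_nat_card_le ?_
    rw [h.card, Nat.card_prod, hcard, Nat.card_eq_fintype_card (α := Angle5), mul_comm]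
    rfl
  let e := (Equiv.ofBijective Φ hbij).symm
  have he : ∀ d, Φ (e d) = d := (Equiv.ofBijective Φ hbij).apply_symm_apply
  refine ⟨e, fun d => hbij.1 ?_, fun d => hbij.1 ?_, fun d => ?_⟩
  · exact (he _).trans ((congrArg T.face (he d)).symm.trans (hΦf _).symm)
  · exact (he _).trans ((congrArg T.edge (he d)).symm.trans (hΦe _).symm)
  · change r (e d).2 = T.label d
    rw [← hpos, he, h.label_eq]

end LabelledMap.IsReducedBy

-- The classification.

universe u in
theorem isTilingFor_reducedAVC_iff {D₀ : Type*} [Fintype D₀] {D : Type u} [Fintype D]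
    (T : LabelledMap D Angle4) {M : SurfaceMap D₀} {q N k l : ℕ} (hN : N ≠ 0)
    (hcard : Nat.card D₀ = N) (hM : SurfaceMap.IsUniversal.{u} M q) (hc : M.Connected)
    (hv : ∀ d, Function.minimalPeriod M.vertex d = 3)
    (hf : ∀ d, Function.minimalPeriod M.face d = q)
    (hq : 2 ≤ q) (hk : N = 3 * k) (hl : N = q * l) (hE : 2 * (k + l) = N + 4) :
    T.IsTilingFor (reducedAVC N k l q) ↔
      T.Iso (M.pentagonalSubdivision.relabel reduction4A1) ∨
      T.Iso (M.pentagonalSubdivision.relabel reduction4A2) ∨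
        T.Iso (M.pentagonalSubdivision.relabel reduction4A3) := by
  have h1 : (∃ r, IsReduction r ∧ T.Iso (M.pentagonalSubdivision.relabel r)) ↔
      T.Iso (M.pentagonalSubdivision.relabel reduction4A1) ∨
      T.Iso (M.pentagonalSubdivision.relabel reduction4A2) ∨
        T.Iso (M.pentagonalSubdivision.relabel reduction4A3) := by
    simp [IsReduction, or_and_right, exists_or]
  rw [← h1]
  constructor
  · intro h
    obtain ⟨r, hr, pos, h | h⟩ := h.exists_isReducedBy hq hN
    · exact ⟨r, hr, Or.inl (h.orientedIso hN hcard hM)⟩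
    · exact ⟨r, hr, Or.inr (h.orientedIso hN hcard hM)⟩
  · rintro ⟨r, hr, h⟩
    have h0 := SurfaceMap.pentagonalSubdivision_isReducedBy hc hcard hv hf r
    rcases h with h | h
    · obtain ⟨pos, h2⟩ := h0.of_orientedIso h
      exact h2.isTilingFor hr hq hk hl hE
    · obtain ⟨pos, h2⟩ := h0.of_orientedIso h
      rw [← T.mirror_mirror]
      exact (h2.isTilingFor hr hq hk hl hE).mirror

/-- The tilings for the two anglewise vertex combinations are, up to isomorphism, exactly the three
reductions of the pentagonal subdivisions of the cube and of the dodecahedron. -/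
theorem theorem10 {D : Type*} [Fintype D] (T : LabelledMap D Angle4) :
    (T.IsTilingFor AVC4A24 ↔
      T.Iso (PP6.relabel reduction4A1) ∨ T.Iso (PP6.relabel reduction4A2) ∨
        T.Iso (PP6.relabel reduction4A3)) ∧
    (T.IsTilingFor AVC4A60 ↔
      T.Iso (PP12.relabel reduction4A1) ∨ T.Iso (PP12.relabel reduction4A2) ∨
        T.Iso (PP12.relabel reduction4A3)) :=
  -- `AVC4A24` and `AVC4A60` unfold to `reducedAVC 24 8 6 4` and `reducedAVC 60 20 12 5`; the
  -- parameters are the numbers of darts, vertices and faces of the polyhedron and the degree of its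
  -- faces.
  ⟨isTilingFor_reducedAVC_iff T (q := 4) (N := 24) (k := 8) (l := 6) (by norm_num)
      (by simp) cube_isUniversal cube_connected cube_vertex_period cube_face_period
      (by norm_num) (by norm_num) (by norm_num) (by norm_num),
    isTilingFor_reducedAVC_iff T (q := 5) (N := 60) (k := 20) (l := 12) (by norm_num)
      (by simp) dodecahedron_isUniversal dodecahedron_connected dodecahedron_vertex_period
      dodecahedron_face_period (by norm_num) (by norm_num) (by norm_num) (by norm_num)⟩
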